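/- Let $K$ be a field and $D$ a set. Let $\mathcal H^D$ be the free associative unital $K$-algebra generated by the planar rooted trees whose vertices are decorated by elements of $D$; its basis is the set of planar decorated forests $F=t_1\cdots t_n$, the empty forest being $1$. Let $\mathcal A^D$ be its augmentation ideal, spanned by the nonempty forests. For $d\in D$ let $\bullet_d$ be the tree with a single vertex, decorated by $d$, and let $B_d(F)$ be the tree obtained by grafting the trees of a forest $F$, in order, on a common root decorated by $d$. A bidendriform bialgebra is a vector space $A$ with bilinear products $\prec,\succ$ and linear coproducts $\Delta_\prec,\Delta_\succ:A\to A\otimes A$ such that, with $ab=a\prec b+a\succ b$, $\tilde\Delta=\Delta_\prec+\Delta_\succ$, and the notations $\tilde\Delta(a)=a'\otimes a''$, $\Delta_\prec(b)=b'_\prec\otimes b''_\prec$, $\Delta_\succ(b)=b'_\succ\otimes b''_\succ$ (sums understood), - $(a\prec b)\prec c=a\prec(bc)$, $(a\succ b)\prec c=a\succ(b\prec c)$, $(ab)\succ c=a\succ(b\succ c)$; - $(\Delta_\prec\otimes\mathrm{Id})\Delta_\prec=(\mathrm{Id}\otimes\tilde\Delta)\Delta_\prec$, $(\Delta_\succ\otimes\mathrm{Id})\Delta_\prec=(\mathrm{Id}\otimes\Delta_\prec)\Delta_\succ$,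 $(\tilde\Delta\otimes\mathrm{Id})\Delta_\succ=(\mathrm{Id}\otimes\Delta_\succ)\Delta_\succ$; - $\Delta_\succ(a\succ b)=a'b'_\succ\otimes a''\succ b''_\succ+a'\otimes a''\succ b+b'_\succ\otimes a\succ b''_\succ+ab'_\succ\otimes b''_\succ+a\otimes b$; - $\Delta_\succ(a\prec b)=a'b'_\succ\otimes a''\prec b''_\succ+a'\otimes a''\prec b+b'_\succ\otimes a\prec b''_\succ$; - $\Delta_\prec(a\succ b)=a'b'_\prec\otimes a''\succ b''_\prec+ab'_\prec\otimes b''_\prec+b'_\prec\otimes a\succ b''_\prec$; - $\Delta_\prec(a\prec b)=a'b'_\prec\otimes a''\prec b''_\prec+a'b\otimes a''+b'_\prec\otimes a\prec b''_\prec+b\otimes a$. Equip $\mathcal A^D$ with its structure of bidendriform bialgebra: $\prec+\succ$ is the product of $\mathcal H^D$, $\bullet_d\prec x=B_d(x)$ for all $d\in D$ and $x\in\mathcal A^D$, and $\Delta_\prec(\bullet_d)=\Delta_\succ(\bullet_d)=0$ for all $d\in D$. Explicitly, for a nonempty forest $F$, $\tilde\Delta(F)=\sum_c P^c(F)\otimes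 R^c(F)$ over all admissible cuts $c$ of $F$ other than the empty and the total one ($R^c(F)$ being the part that contains the roots left uncut, $P^c(F)$ the forest of the parts cut off), $\Delta_\prec(F)$ is the sum of the terms for which $c$ cuts an edge on the path from the root of the last tree of $F$ to its rightmost leaf, or cuts the last tree of $F$ totally, and $\Delta_\succ=\tilde\Delta-\Delta_\prec$. Then the space of totally primitive elements $\mathrm{Prim}_{tot}(\mathcal A^D)=\{a\in\mathcal A^D : \Delta_\prec(a)=0 \text{ and } \Delta_\succ(a)=0\}$ is exactly the linear span of the single-vertex trees: $$\mathrm{Prim}_{tot}(\mathcal A^D)=\mathrm{Vect}(\bullet_d : d\in D).$$ -/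

import Mathlib

open scoped TensorProduct

namespace Bidend

section Structures

/-- A dendriform algebra: a vector space with two bilinear products. -/
class DendriformAlgebra (K A : Type*) [Field K] [AddCommGroup A] [Module K A] where
  /-- the left product `a ≺ b` -/
  prec : A →ₗ[K] A →ₗ[K] A
  /-- the right product `a ≻ b` -/
  succ : A →ₗ[K] A →ₗ[K] A
  prec_prec : ∀ a b c : A, prec (prec a b) c = prec a (prec b c + succ b c)
  succ_prec : ∀ a b c : A, prec (succ a b) c = succ a (prec b c)
  succ_succ : ∀ a b c : A, succ (prec a b + succ a b) c = succ a (succ b c)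

/-- A dendriform coalgebra: a vector space with two coproducts. The isomorphism
`(A ⊗ A) ⊗ A ≃ A ⊗ (A ⊗ A)` is written explicitly. -/
class DendriformCoalgebra (K A : Type*) [Field K] [AddCommGroup A] [Module K A] where
  /-- the left coproduct -/
  coprec : A →ₗ[K] A ⊗[K] A
  /-- the right coproduct -/
  cosucc : A →ₗ[K] A ⊗[K] A
  coprec_coprec : ∀ a : A,
    TensorProduct.assoc K A A A (coprec.rTensor A (coprec a)) =
      (coprec + cosucc).lTensor A (coprec a)
  cosucc_coprec : ∀ a : A,
    TensorProduct.assoc K A A A (cosucc.rTensor A (coprec a)) =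
      coprec.lTensor A (cosucc a)
  cosucc_cosucc : ∀ a : A,
    TensorProduct.assoc K A A A ((coprec + cosucc).rTensor A (cosucc a)) =
      cosucc.lTensor A (cosucc a)

/-- The associative product `a b = a ≺ b + a ≻ b` of a dendriform algebra. -/
def dmul (K : Type*) {A : Type*} [Field K] [AddCommGroup A] [Module K A]
    [DendriformAlgebra K A] : A →ₗ[K] A →ₗ[K] A :=
  DendriformAlgebra.prec + DendriformAlgebra.succ

/-- The coassociative coproduct `Δ_≺ + Δ_≻` of a dendriform coalgebra. -/
def redCoprod (K : Type*) {A : Type*} [Field K] [AddCommGroup A] [Module K A]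
    [DendriformCoalgebra K A] : A →ₗ[K] A ⊗[K] A :=
  DendriformCoalgebra.coprec + DendriformCoalgebra.cosucc

open DendriformAlgebra DendriformCoalgebra TensorProduct in
/-- A bidendriform bialgebra: a dendriform algebra and a dendriform coalgebra with four
compatibilities. In Sweedler notation, with `a' ⊗ a''` for `(Δ_≺ + Δ_≻) a` and
`b'_≺ ⊗ b''_≺` for `Δ_≺ b`, the term `a' b'_≺ ⊗ (a'' ≺ b''_≺)` is
`map₂ (dmul K) prec (redCoprod K a) (coprec b)`, the term `a' ⊗ (a'' ≺ b)` is
`(prec.flip b).lTensor A (redCoprod K a)`, the term `b'_≺ ⊗ (a ≺ b''_≺)` is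
`(prec a).lTensor A (coprec b)`, the term `a b'_≺ ⊗ b''_≺` is
`(dmul K a).rTensor A (coprec b)`, and the term `a' b ⊗ a''` is
`((dmul K).flip b).rTensor A (redCoprod K a)`. -/
class BidendriformBialgebra (K A : Type*) [Field K] [AddCommGroup A] [Module K A]
    extends DendriformAlgebra K A, DendriformCoalgebra K A where
  cosucc_succ : ∀ a b : A, cosucc (succ a b) =
    map₂ (dmul K) succ (redCoprod K a) (cosucc b) + (succ.flip b).lTensor A (redCoprod K a)
      + (succ a).lTensor A (cosucc b) + (dmul K a).rTensor A (cosucc b) + a ⊗ₜ[K] b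
  cosucc_prec : ∀ a b : A, cosucc (prec a b) =
    map₂ (dmul K) prec (redCoprod K a) (cosucc b) + (prec.flip b).lTensor A (redCoprod K a)
      + (prec a).lTensor A (cosucc b)
  coprec_succ : ∀ a b : A, coprec (succ a b) =
    map₂ (dmul K) succ (redCoprod K a) (coprec b) + (dmul K a).rTensor A (coprec b)
      + (succ a).lTensor A (coprec b)
  coprec_prec : ∀ a b : A, coprec (prec a b) =
    map₂ (dmul K) prec (redCoprod K a) (coprec b) + ((dmul K).flip b).rTensor A (redCoprod K a)
      + (prec a).lTensor A (coprec b) + b ⊗ₜ[K] a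

/-- The subspace of totally primitive elements `{a | Δ_≺ a = 0 and Δ_≻ a = 0}`. -/
def primTot (K A : Type*) [Field K] [AddCommGroup A] [Module K A]
    [DendriformCoalgebra K A] : Submodule K A :=
  LinearMap.ker (DendriformCoalgebra.coprec : A →ₗ[K] A ⊗[K] A) ⊓
    LinearMap.ker (DendriformCoalgebra.cosucc : A →ₗ[K] A ⊗[K] A)

end Structures

/-- Planar rooted trees with vertices decorated by `D`: a root decoration together with the
list, from left to right, of the subtrees attached to the root. -/
inductive PTree (D : Type*) where
  | node : D → List (PTree D) → PTree D

/-- The free associative algebra on the planar decorated rooted trees. Its monomials are the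
planar decorated forests, a forest being the word (list) of its trees from left to right; the
empty forest is `1`. -/
def HD (K D : Type*) [Field K] := FreeAlgebra K (PTree D)

noncomputable instance (K D : Type*) [Field K] : Ring (HD K D) :=
  inferInstanceAs (Ring (FreeAlgebra K (PTree D)))

noncomputable instance (K D : Type*) [Field K] : Algebra K (HD K D) :=
  inferInstanceAs (Algebra K (FreeAlgebra K (PTree D)))

section Algebra

variable (K : Type*) {D : Type*} [Field K]

/-- A tree as a generator of the algebra. -/
noncomputable def tree (t : PTree D) : HD K D := FreeAlgebra.ι K t

/-- The forest `t₁ … tₙ` as an element of the algebra. -/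
noncomputable def mon (l : List (PTree D)) : HD K D := (l.map (tree K)).prod

/-- The universal property of the free algebra. -/
noncomputable def algLift {A : Type*} [Ring A] [Algebra K A] (f : PTree D → A) : HD K D →ₐ[K] A :=
  FreeAlgebra.lift K f

theorem algLift_tree {A : Type*} [Ring A] [Algebra K A] (f : PTree D → A) (t : PTree D) :
    algLift K f (tree K t) = f t :=
  FreeAlgebra.lift_ι_apply f t

/-- The basis of planar decorated forests. -/
noncomputable def forestBasis : Module.Basis (List (PTree D)) K (HD K D) :=
  FreeAlgebra.basisFreeMonoid K (PTree D)

theorem forestBasis_apply (l : List (PTree D)) : forestBasis K l = mon K l := by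
  change FreeAlgebra.basisFreeMonoid K (PTree D) (FreeMonoid.ofList l) = _
  simp only [FreeAlgebra.basisFreeMonoid, Module.Basis.map_apply, Finsupp.coe_basisSingleOne]
  change FreeAlgebra.equivMonoidAlgebraFreeMonoid.symm
    (MonoidAlgebra.single (FreeMonoid.ofList l) (1 : K)) = _
  simp only [FreeAlgebra.equivMonoidAlgebraFreeMonoid, AlgEquiv.ofAlgHom_symm_apply,
    MonoidAlgebra.lift_single, one_smul, FreeMonoid.lift_apply, FreeMonoid.toList_ofList]
  rfl

/-- Linear extension of a map defined on forests. -/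
noncomputable def linExt {M : Type*} [AddCommGroup M] [Module K M]
    (f : List (PTree D) → M) : HD K D →ₗ[K] M :=
  (forestBasis K).constr K f

/-- The counit: `1 ↦ 1`, every tree goes to `0`. -/
noncomputable def counit : HD K D →ₐ[K] K :=
  algLift K (fun _ => 0)

/-- Grafting the trees of a forest on a common root decorated by `d`. -/
noncomputable def graft (d : D) : HD K D →ₗ[K] HD K D :=
  linExt K (fun l => mon K [PTree.node d l])

mutual
/-- Sum of `P^c(t) ⊗ R^c(t)` over all admissible cuts `c` of a tree `t`, including the empty and
the total one: a cut is either total, or given by a cut of the forest above the root. -/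
noncomputable def cutTree : PTree D → HD K D ⊗[K] HD K D
  | PTree.node d l =>
      (graft K d).lTensor (HD K D) (cutForest l) + mon K [PTree.node d l] ⊗ₜ[K] 1
/-- The same sum for a forest. -/
noncomputable def cutForest : List (PTree D) → HD K D ⊗[K] HD K D
  | [] => 1
  | t :: l => cutTree t * cutForest l
end

mutual
/-- Sum of `P^c(t) ⊗ R^c(t)` over the cuts of a tree which are total or cut an edge of the path
from the root to the rightmost leaf. -/
noncomputable def rcutTree : PTree D → HD K D ⊗[K] HD K D
  | PTree.node d l =>
      (graft K d).lTensor (HD K D) (rcutForest l) + mon K [PTree.node d l] ⊗ₜ[K] 1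
/-- Sum of `P^c(F) ⊗ R^c(F)` over the cuts of a forest whose restriction to the last tree is of
the kind above (no such cut for the empty forest). -/
noncomputable def rcutForest : List (PTree D) → HD K D ⊗[K] HD K D
  | [] => 0
  | [t] => rcutTree t
  | t :: s :: l => cutTree K t * rcutForest (s :: l)
end

/-- The Hopf algebra coproduct `Δ(F) = ∑ P^c(F) ⊗ R^c(F)` over all admissible cuts. -/
noncomputable def coprod : HD K D →ₐ[K] HD K D ⊗[K] HD K D :=
  algLift K (cutTree K)

/-- The part of `Δ(F)` given by the cuts of `rcutForest`. -/
noncomputable def rcoprod : HD K D →ₗ[K] HD K D ⊗[K] HD K D :=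
  linExt K (fun l => rcutForest K l)

/-- The part of `Δ(F)` given by all other cuts. -/
noncomputable def lcoprod : HD K D →ₗ[K] HD K D ⊗[K] HD K D :=
  (coprod K (D := D)).toLinearMap - rcoprod K

/-- The map `x ↦ F ≺ x` for a forest `F`. It is forced by `•_d ≺ x = B_d(x)`, where `•_d` is the
tree with one vertex and `B_d` the grafting, and by the dendriform axioms with `≺ + ≻` the product of
the free algebra: `B_d(G) ≺ x = (•_d ≺ G) ≺ x = •_d ≺ (G x) = B_d(G x)`, and for a forest `t F` with
first tree `t = B_d(G)`, from `t F = t ≺ F + t ≻ F`,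
`(t F) ≺ x = t ≺ (F x) + t ≻ (F ≺ x) = t (F ≺ x) + B_d(G (F ≻ x))`. The two cases are one with the
conventions `1 ≺ x = 0` and `1 ≻ x = x`. -/
noncomputable def precForest : List (PTree D) → HD K D →ₗ[K] HD K D
  | [] => 0
  | PTree.node d l :: F =>
      LinearMap.mulLeft K (mon K [PTree.node d l]) ∘ₗ precForest F +
        graft K d ∘ₗ LinearMap.mulLeft K (mon K l) ∘ₗ
          (LinearMap.mulLeft K (mon K F) - precForest F)

/-- The left product, extended by `1 ≺ x = 0`. -/
noncomputable def hprec : HD K D →ₗ[K] HD K D →ₗ[K] HD K D :=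
  linExt K (fun l => precForest K l)

/-- The right product, extended by `1 ≻ x = x`. -/
noncomputable def hsucc : HD K D →ₗ[K] HD K D →ₗ[K] HD K D :=
  LinearMap.mul K (HD K D) - hprec K

theorem linExt_mon {M : Type*} [AddCommGroup M] [Module K M]
    (f : List (PTree D) → M) (l : List (PTree D)) : linExt K f (mon K l) = f l := by
  rw [linExt, ← forestBasis_apply, Module.Basis.constr_basis]

theorem mon_nil : mon K ([] : List (PTree D)) = 1 := rfl

theorem mon_append (l l' : List (PTree D)) : mon K (l ++ l') = mon K l * mon K l' := by
  simp [mon]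

theorem mon_cons (t : PTree D) (l : List (PTree D)) : mon K (t :: l) = mon K [t] * mon K l := by
  rw [← mon_append]; rfl

theorem hd_ext {M : Type*} [AddCommGroup M] [Module K M] {f g : HD K D →ₗ[K] M}
    (h : ∀ l, f (mon K l) = g (mon K l)) : f = g :=
  (forestBasis K).ext fun l => by rw [forestBasis_apply, h]

theorem hd_ext_apply {M : Type*} [AddCommGroup M] [Module K M] {f g : HD K D →ₗ[K] M}
    (h : ∀ l, f (mon K l) = g (mon K l)) (x : HD K D) : f x = g x := by
  rw [hd_ext K h]

theorem graft_mon (d : D) (l : List (PTree D)) : graft K d (mon K l) = mon K [PTree.node d l] :=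
  linExt_mon K _ l

theorem counit_nil : counit K (mon K ([] : List (PTree D))) = 1 := by rw [mon_nil, map_one]

theorem counit_tree (t : PTree D) : counit K (mon K [t]) = 0 := by
  simp [counit, mon, algLift_tree]

theorem counit_cons (t : PTree D) (l : List (PTree D)) : counit K (mon K (t :: l)) = 0 := by
  rw [mon_cons, map_mul, counit_tree, zero_mul]

theorem counit_graft (d : D) (x : HD K D) : counit K (graft K d x) = 0 :=
  hd_ext_apply K (f := (counit K).toLinearMap ∘ₗ graft K d) (g := 0)
    (fun l => by simp [graft_mon, counit_tree]) x

theorem coprod_tree (t : PTree D) : coprod K (mon K [t]) = cutTree K t := by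
  simp [coprod, mon, algLift_tree]

theorem coprod_mon (l : List (PTree D)) : coprod K (mon K l) = cutForest K l := by
  induction l with
  | nil => rw [mon_nil, map_one]; simp [cutForest]
  | cons t l ih => rw [mon_cons, map_mul, ih, coprod_tree, cutForest]

theorem rcoprod_mon (l : List (PTree D)) : rcoprod K (mon K l) = rcutForest K l :=
  linExt_mon K _ l

theorem rcoprod_one : rcoprod K (1 : HD K D) = 0 := by
  rw [← mon_nil, rcoprod_mon, rcutForest]

theorem coprod_graft (d : D) (x : HD K D) : coprod K (graft K d x) =
    (graft K d).lTensor _ (coprod K x) + graft K d x ⊗ₜ[K] 1 :=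
  hd_ext_apply K (f := (coprod K (D := D)).toLinearMap ∘ₗ graft K d)
    (g := (graft K d).lTensor _ ∘ₗ (coprod K (D := D)).toLinearMap +
      (TensorProduct.mk K _ _).flip (1 : HD K D) ∘ₗ graft K d)
    (fun l => by simp [graft_mon, cutForest, cutTree, coprod_mon]) x

theorem rcoprod_graft (d : D) (x : HD K D) : rcoprod K (graft K d x) =
    (graft K d).lTensor _ (rcoprod K x) + graft K d x ⊗ₜ[K] 1 :=
  hd_ext_apply K (f := rcoprod K ∘ₗ graft K d)
    (g := (graft K d).lTensor _ ∘ₗ rcoprod K +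
      (TensorProduct.mk K _ _).flip 1 ∘ₗ graft K d)
    (fun l => by simp [graft_mon, rcutForest, rcutTree, rcoprod_mon]) x

theorem rcoprod_mul_mon (l m : List (PTree D)) : rcoprod K (mon K l * mon K m) =
    coprod K (mon K l) * rcoprod K (mon K m) + counit K (mon K m) • rcoprod K (mon K l) := by
  cases m with
  | nil => simp [mon_nil, rcoprod_one]
  | cons s m =>
    rw [counit_cons, zero_smul, add_zero, ← mon_append]
    induction l with
    | nil => simp [mon_nil]
    | cons t l ih =>
      rw [mon_cons K t l, map_mul, mul_assoc, ← ih, coprod_tree]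
      rw [rcoprod_mon, rcoprod_mon]
      cases l <;> simp [rcutForest]

theorem rcoprod_mul (x y : HD K D) : rcoprod K (x * y) =
    coprod K x * rcoprod K y + counit K y • rcoprod K x := by
  have h : (LinearMap.mul K (HD K D)).compr₂ (rcoprod K) =
      (LinearMap.mul K _).compl₁₂ (coprod K (D := D)).toLinearMap (rcoprod K) +
        ((LinearMap.lsmul K _).flip ∘ₗ rcoprod K).compl₂ (counit K).toLinearMap :=
    hd_ext K fun l => hd_ext K fun m => by simpa using rcoprod_mul_mon K l m
  simpa using congr($h x y)

theorem lcoprod_apply (x : HD K D) : lcoprod K x = coprod K x - rcoprod K x := rfl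

theorem lcoprod_one : lcoprod K (1 : HD K D) = 1 := by
  rw [lcoprod_apply, rcoprod_one, map_one, sub_zero]

theorem lcoprod_graft (d : D) (x : HD K D) : lcoprod K (graft K d x) =
    (graft K d).lTensor _ (lcoprod K x) := by
  rw [lcoprod_apply, lcoprod_apply, coprod_graft, rcoprod_graft, map_sub]; abel

theorem lcoprod_mul (x y : HD K D) : lcoprod K (x * y) =
    coprod K x * lcoprod K y - counit K y • rcoprod K x := by
  rw [lcoprod_apply, lcoprod_apply, rcoprod_mul, map_mul, mul_sub]; abel

theorem hprec_one (x : HD K D) : hprec K 1 x = 0 := by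
  rw [← mon_nil, hprec, linExt_mon, precForest]; rfl

theorem hsucc_apply (x y : HD K D) : hsucc K x y = x * y - hprec K x y := rfl

theorem hprec_graft_mul (d : D) (g x y : HD K D) :
    hprec K (graft K d g * x) y =
      graft K d g * hprec K x y + graft K d (g * hsucc K x y) := by
  have h : ((LinearMap.mul K (HD K D)).compr₂ ((hprec K).flip y)) ∘ₗ graft K d =
      (LinearMap.mul K _ ∘ₗ graft K d).compl₂ ((hprec K).flip y)
        + ((LinearMap.mul K _).compr₂ (graft K d)).compl₂ ((hsucc K).flip y) :=
    hd_ext K fun l => hd_ext K fun m => by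
      simp only [LinearMap.coe_comp, Function.comp_apply, LinearMap.compr₂_apply,
        LinearMap.mul_apply', LinearMap.flip_apply, LinearMap.add_apply, LinearMap.compl₂_apply,
        graft_mon, ← mon_cons, hsucc_apply]
      simp [hprec, linExt_mon, precForest]
  simpa using congr($h g x)

theorem hprec_graft (d : D) (g y : HD K D) :
    hprec K (graft K d g) y = graft K d (g * y) := by
  have := hprec_graft_mul K d g 1 y
  simpa [hprec_one, hsucc_apply] using this

theorem forest_induction {p : List (PTree D) → Prop} (nil : p [])
    (cons : ∀ d l F, p l → p F → p (PTree.node d l :: F)) (l : List (PTree D)) : p l :=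
  PTree.rec_1 (motive_1 := fun t => ∀ F, p F → p (t :: F)) (motive_2 := p)
    (fun d l ih F hF => cons d l F ih hF) nil (fun _ l ht hl => ht l hl) l

/-- Induction on elements of the algebra along products `B_d(g) x`. -/
theorem hd_induction {M : Type*} [AddCommGroup M] [Module K M] {f g : HD K D →ₗ[K] M}
    (one : f 1 = g 1)
    (step : ∀ d x y, f x = g x → f y = g y → f (graft K d x * y) = g (graft K d x * y))
    (x : HD K D) : f x = g x :=
  hd_ext_apply K (fun l => by
    induction l using forest_induction with
    | nil => exact one
    | cons d l F hl hF => rw [mon_cons, ← graft_mon]; exact step d _ _ hl hF) x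

theorem counit_hprec (x y : HD K D) : counit K (hprec K x y) = 0 := by
  refine hd_induction K (f := (counit K).toLinearMap ∘ₗ (hprec K).flip y) (g := 0) ?_ ?_ x
  · simp [hprec_one]
  · intro d a b _ _
    simp [hprec_graft_mul, counit_graft]

theorem counit_hsucc (x y : HD K D) : counit K (hsucc K x y) = counit K x * counit K y := by
  rw [hsucc_apply, map_sub, counit_hprec, sub_zero, map_mul]

theorem hprec_one_right (x : HD K D) : hprec K x 1 = x - counit K x • 1 := by
  refine hd_induction K (f := (hprec K).flip 1)
    (g := LinearMap.id - (LinearMap.toSpanSingleton K _ 1) ∘ₗ (counit K).toLinearMap) ?_ ?_ x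
  · simp [hprec_one]
  · intro d a b _ hb
    replace hb : hprec K b 1 = b - counit K b • 1 := hb
    simp [hprec_graft_mul, counit_graft, hb, hsucc_apply]
    rw [mul_sub]; simp

theorem hsucc_one_right (x : HD K D) : hsucc K x 1 = counit K x • 1 := by
  rw [hsucc_apply, hprec_one_right]; simp

theorem hprec_hprec (a b c : HD K D) : hprec K (hprec K a b) c = hprec K a (b * c) := by
  refine hd_induction K (f := (hprec K).flip c ∘ₗ (hprec K).flip b)
    (g := (hprec K).flip (b * c)) ?_ ?_ a
  · simp [hprec_one]
  · intro d x y _ hy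
    replace hy : hprec K (hprec K y b) c = hprec K y (b * c) := hy
    simp only [LinearMap.coe_comp, Function.comp_apply, LinearMap.flip_apply]
    rw [hprec_graft_mul, map_add, LinearMap.add_apply, hprec_graft_mul, hprec_graft,
      hprec_graft_mul, hy, add_assoc, ← map_add]
    simp only [hsucc_apply, hy]
    congr 2
    noncomm_ring

theorem hsucc_hprec (a b c : HD K D) : hprec K (hsucc K a b) c = hsucc K a (hprec K b c) := by
  refine hd_induction K (f := (hprec K).flip c ∘ₗ (hsucc K).flip b)
    (g := (hsucc K).flip (hprec K b c)) ?_ ?_ a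
  · simp [hprec_one, hsucc_apply]
  · intro d x y _ hy
    replace hy : hprec K (hsucc K y b) c = hsucc K y (hprec K b c) := hy
    simp only [LinearMap.coe_comp, Function.comp_apply, LinearMap.flip_apply]
    have e : hsucc K (graft K d x * y) b =
        graft K d x * hsucc K y b - graft K d (x * hsucc K y b) := by
      rw [hsucc_apply, hprec_graft_mul, hsucc_apply]; noncomm_ring
    rw [e, map_sub, LinearMap.sub_apply, hprec_graft_mul, hprec_graft, hy,
      hsucc_apply K (graft K d x * y), hprec_graft_mul,
      hsucc_apply K (hsucc K y b), hy, mul_sub, map_sub, ← mul_assoc x]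
    simp only [hsucc_apply K y, mul_sub, map_sub]
    noncomm_ring

open TensorProduct

theorem tp_add_ts (X Y : HD K D ⊗[K] HD K D) :
    map₂ (LinearMap.mul K _) (hprec K) X Y + map₂ (LinearMap.mul K _) (hsucc K) X Y = X * Y := by
  induction X using TensorProduct.induction_on with
  | zero => simp
  | add X X' h h' => simp only [map_add, LinearMap.add_apply, add_mul, ← h, ← h']; abel
  | tmul a b =>
    induction Y using TensorProduct.induction_on with
    | zero => simp
    | add Y Y' h h' => simp only [map_add, mul_add, ← h, ← h']; abel
    | tmul c d => simp [map₂_apply_tmul, ← tmul_add, hsucc_apply]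

theorem tp_graft_mul (d : D) (G X Y : HD K D ⊗[K] HD K D) :
    map₂ (LinearMap.mul K _) (hprec K) ((graft K d).lTensor _ G * X) Y =
      (graft K d).lTensor _ G * map₂ (LinearMap.mul K _) (hprec K) X Y +
        (graft K d).lTensor _ (G * map₂ (LinearMap.mul K _) (hsucc K) X Y) := by
  induction G using TensorProduct.induction_on with
  | zero => simp
  | add X X' h h' => simp only [map_add, LinearMap.add_apply, add_mul, h, h']; abel
  | tmul a b =>
    induction X using TensorProduct.induction_on with
    | zero => simp
    | add X X' h h' => simp only [map_add, LinearMap.add_apply, mul_add, h, h']; abel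
    | tmul a' b' =>
      induction Y using TensorProduct.induction_on with
      | zero => simp
      | add Y Y' h h' => simp only [map_add, mul_add, h, h']; abel
      | tmul a'' b'' => simp [map₂_apply_tmul, ← tmul_add, hprec_graft_mul, mul_assoc]

theorem tp_tmul_one_mul (t : HD K D) (X Y : HD K D ⊗[K] HD K D) :
    map₂ (LinearMap.mul K _) (hprec K) ((t ⊗ₜ[K] 1) * X) Y =
      (t ⊗ₜ[K] 1) * map₂ (LinearMap.mul K _) (hprec K) X Y := by
  induction X using TensorProduct.induction_on with
  | zero => simp
  | add X X' h h' => simp only [map_add, LinearMap.add_apply, mul_add, h, h']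
  | tmul a' b' =>
    induction Y using TensorProduct.induction_on with
    | zero => simp
    | add Y Y' h h' => simp only [map_add, mul_add, h, h']
    | tmul a'' b'' => simp [map₂_apply_tmul, mul_assoc]

theorem tp_coprod_graft_mul (d : D) (g : HD K D) (X Y : HD K D ⊗[K] HD K D) :
    map₂ (LinearMap.mul K _) (hprec K) (coprod K (graft K d g) * X) Y =
      coprod K (graft K d g) * map₂ (LinearMap.mul K _) (hprec K) X Y +
        (graft K d).lTensor _ (coprod K g * map₂ (LinearMap.mul K _) (hsucc K) X Y) := by
  rw [coprod_graft, add_mul, map_add, LinearMap.add_apply, tp_graft_mul, tp_tmul_one_mul, add_mul]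
  abel

theorem lcoprod_hprec (a b : HD K D) (hb : counit K b = 0) :
    lcoprod K (hprec K a b) =
      map₂ (LinearMap.mul K _) (hprec K) (coprod K a) (lcoprod K b) := by
  refine hd_induction K (f := lcoprod K ∘ₗ (hprec K).flip b)
    (g := (map₂ (LinearMap.mul K _) (hprec K)).flip (lcoprod K b) ∘ₗ
      (coprod K (D := D)).toLinearMap) ?_ ?_ a
  · simp only [LinearMap.coe_comp, Function.comp_apply, LinearMap.flip_apply, hprec_one, map_zero,
      AlgHom.toLinearMap_apply, map_one]
    have h0 : map₂ (LinearMap.mul K (HD K D)) (hprec K) (1 : HD K D ⊗[K] HD K D) = 0 := by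
      ext; simp [Algebra.TensorProduct.one_def, map₂_apply_tmul, hprec_one]
    rw [h0]; rfl
  · intro d x y _ hy
    replace hy : lcoprod K (hprec K y b) =
      map₂ (LinearMap.mul K _) (hprec K) (coprod K y) (lcoprod K b) := hy
    simp only [LinearMap.coe_comp, Function.comp_apply, LinearMap.flip_apply,
      AlgHom.toLinearMap_apply]
    have hs : lcoprod K (hsucc K y b) =
        map₂ (LinearMap.mul K _) (hsucc K) (coprod K y) (lcoprod K b) := by
      rw [hsucc_apply, map_sub, hy, lcoprod_mul, hb, ← tp_add_ts]; simp
    rw [hprec_graft_mul, map_add, lcoprod_mul, lcoprod_graft, lcoprod_mul, counit_hprec,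
      counit_hsucc, hb, hs, hy, map_mul (coprod K), tp_coprod_graft_mul]
    simp

theorem lcoprod_hsucc (a b : HD K D) (hb : counit K b = 0) :
    lcoprod K (hsucc K a b) =
      map₂ (LinearMap.mul K _) (hsucc K) (coprod K a) (lcoprod K b) := by
  rw [hsucc_apply, map_sub, lcoprod_hprec K a b hb, lcoprod_mul, hb, ← tp_add_ts]; simp

theorem lTensor_mul_tmul_one (f : HD K D →ₗ[K] HD K D) (X : HD K D ⊗[K] HD K D) (y : HD K D) :
    f.lTensor _ (X * y ⊗ₜ[K] 1) = f.lTensor _ X * y ⊗ₜ[K] 1 := by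
  induction X using TensorProduct.induction_on with
  | zero => simp
  | add X X' h h' => simp only [map_add, add_mul, h, h']
  | tmul a b => simp

theorem rcoprod_hprec (a b : HD K D) (hb : counit K b = 0) :
    rcoprod K (hprec K a b) =
      map₂ (LinearMap.mul K _) (hprec K) (coprod K a) (rcoprod K b) + hprec K a b ⊗ₜ[K] 1 := by
  refine hd_induction K (f := rcoprod K ∘ₗ (hprec K).flip b)
    (g := (map₂ (LinearMap.mul K _) (hprec K)).flip (rcoprod K b) ∘ₗ
      (coprod K (D := D)).toLinearMap +
        (TensorProduct.mk K _ _).flip (1 : HD K D) ∘ₗ (hprec K).flip b) ?_ ?_ a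
  · have h0 : map₂ (LinearMap.mul K (HD K D)) (hprec K) (1 : HD K D ⊗[K] HD K D) = 0 := by
      ext; simp [Algebra.TensorProduct.one_def, map₂_apply_tmul, hprec_one]
    simp [hprec_one, h0]
  · intro d x y _ hy
    replace hy : rcoprod K (hprec K y b) =
      map₂ (LinearMap.mul K _) (hprec K) (coprod K y) (rcoprod K b) + hprec K y b ⊗ₜ[K] 1 := hy
    simp only [LinearMap.coe_comp, Function.comp_apply, LinearMap.flip_apply,
      AlgHom.toLinearMap_apply, LinearMap.add_apply, mk_apply]
    have hs : rcoprod K (hsucc K y b) =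
        map₂ (LinearMap.mul K _) (hsucc K) (coprod K y) (rcoprod K b) - hprec K y b ⊗ₜ[K] 1 := by
      rw [hsucc_apply, map_sub, hy, rcoprod_mul, hb, ← tp_add_ts]; simp
    rw [hprec_graft_mul, map_add, rcoprod_mul, rcoprod_graft K d (x * _), rcoprod_mul K x, counit_hprec,
      counit_hsucc, hb, hs, hy, map_mul (coprod K), tp_coprod_graft_mul, mul_zero,
      zero_smul, zero_smul, add_zero, add_zero, mul_sub, map_sub,
      lTensor_mul_tmul_one, mul_add]
    nth_rewrite 2 [coprod_graft]
    simp only [add_mul, add_tmul, Algebra.TensorProduct.tmul_mul_tmul, one_mul]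
    abel

theorem rcoprod_hsucc (a b : HD K D) (hb : counit K b = 0) :
    rcoprod K (hsucc K a b) =
      map₂ (LinearMap.mul K _) (hsucc K) (coprod K a) (rcoprod K b) - hprec K a b ⊗ₜ[K] 1 := by
  rw [hsucc_apply, map_sub, rcoprod_hprec K a b hb, rcoprod_mul, hb, ← tp_add_ts]; simp

/-- `x ⊗ y ↦ ε(y) x` -/
noncomputable def e1 : HD K D ⊗[K] HD K D →ₗ[K] HD K D :=
  TensorProduct.lift ((LinearMap.lsmul K (HD K D)).flip.compl₂ (counit K).toLinearMap)

/-- `x ⊗ y ↦ ε(x) y` -/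
noncomputable def e2 : HD K D ⊗[K] HD K D →ₗ[K] HD K D :=
  TensorProduct.lift (LinearMap.lsmul K (HD K D) ∘ₗ (counit K).toLinearMap)

theorem e1_tmul (x y : HD K D) : e1 K (x ⊗ₜ[K] y) = counit K y • x := rfl
theorem e2_tmul (x y : HD K D) : e2 K (x ⊗ₜ[K] y) = counit K x • y := rfl

theorem e1_mul (X Y : HD K D ⊗[K] HD K D) : e1 K (X * Y) = e1 K X * e1 K Y := by
  induction X using TensorProduct.induction_on with
  | zero => simp
  | add X X' h h' => simp only [map_add, add_mul, h, h']
  | tmul a' b' =>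
    induction Y using TensorProduct.induction_on with
    | zero => simp
    | add Y Y' h h' => simp only [map_add, mul_add, h, h']
    | tmul a'' b'' => simp [e1_tmul, smul_smul, mul_comm]

theorem e2_mul (X Y : HD K D ⊗[K] HD K D) : e2 K (X * Y) = e2 K X * e2 K Y := by
  induction X using TensorProduct.induction_on with
  | zero => simp
  | add X X' h h' => simp only [map_add, add_mul, h, h']
  | tmul a' b' =>
    induction Y using TensorProduct.induction_on with
    | zero => simp
    | add Y Y' h h' => simp only [map_add, mul_add, h, h']
    | tmul a'' b'' => simp [e2_tmul, smul_smul, mul_comm]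

theorem e1_lTensor_graft (d : D) (X : HD K D ⊗[K] HD K D) :
    e1 K ((graft K d).lTensor _ X) = 0 := by
  induction X using TensorProduct.induction_on with
  | zero => simp
  | add X X' h h' => simp only [map_add, h, h', add_zero]
  | tmul a b => simp [e1_tmul, counit_graft]

theorem e2_lTensor_graft (d : D) (X : HD K D ⊗[K] HD K D) :
    e2 K ((graft K d).lTensor _ X) = graft K d (e2 K X) := by
  induction X using TensorProduct.induction_on with
  | zero => simp
  | add X X' h h' => simp only [map_add, h, h']
  | tmul a b => simp [e2_tmul]

theorem e1_coprod (x : HD K D) : e1 K (coprod K x) = x := by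
  refine hd_induction K (f := e1 K ∘ₗ (coprod K (D := D)).toLinearMap) (g := LinearMap.id) ?_ ?_ x
  · simp [Algebra.TensorProduct.one_def, e1_tmul]
  · intro d x y _ hy
    replace hy : e1 K (coprod K y) = y := hy
    simp [e1_mul, hy, coprod_graft, e1_lTensor_graft, e1_tmul]

theorem e2_coprod (x : HD K D) : e2 K (coprod K x) = x := by
  refine hd_induction K (f := e2 K ∘ₗ (coprod K (D := D)).toLinearMap) (g := LinearMap.id) ?_ ?_ x
  · simp [Algebra.TensorProduct.one_def, e2_tmul]
  · intro d x y hx hy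
    replace hy : e2 K (coprod K y) = y := hy
    replace hx : e2 K (coprod K x) = x := hx
    simp [e2_mul, hy, coprod_graft, e2_lTensor_graft, e2_tmul, counit_graft, hx]

theorem e1_rcoprod (x : HD K D) : e1 K (rcoprod K x) = x - counit K x • 1 := by
  refine hd_induction K (f := e1 K ∘ₗ rcoprod K)
    (g := LinearMap.id - (LinearMap.toSpanSingleton K _ 1) ∘ₗ (counit K).toLinearMap) ?_ ?_ x
  · simp [rcoprod_one]
  · intro d x y _ hy
    replace hy : e1 K (rcoprod K y) = y - counit K y • 1 := hy
    simp [rcoprod_mul, e1_mul, hy, rcoprod_graft, e1_lTensor_graft, e1_tmul, e1_coprod,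
      counit_graft, mul_sub]

theorem e2_rcoprod (x : HD K D) : e2 K (rcoprod K x) = 0 := by
  refine hd_induction K (f := e2 K ∘ₗ rcoprod K) (g := 0) ?_ ?_ x
  · simp [rcoprod_one]
  · intro d x y hx hy
    replace hy : e2 K (rcoprod K y) = 0 := hy
    replace hx : e2 K (rcoprod K x) = 0 := hx
    simp [rcoprod_mul, e2_mul, hy, rcoprod_graft, e2_lTensor_graft, e2_tmul,
      counit_graft, hx]

theorem e1_lcoprod (x : HD K D) : e1 K (lcoprod K x) = counit K x • 1 := by
  rw [lcoprod_apply, map_sub, e1_coprod, e1_rcoprod]; simp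

theorem e2_lcoprod (x : HD K D) : e2 K (lcoprod K x) = x := by
  rw [lcoprod_apply, map_sub, e2_coprod, e2_rcoprod]; simp

/-- The associativity isomorphism. -/
noncomputable def al : (HD K D ⊗[K] HD K D) ⊗[K] HD K D ≃ₗ[K] HD K D ⊗[K] (HD K D ⊗[K] HD K D) :=
  TensorProduct.assoc K _ _ _

theorem al_tmul (x y z : HD K D) : al K ((x ⊗ₜ[K] y) ⊗ₜ[K] z) = x ⊗ₜ[K] (y ⊗ₜ[K] z) := rfl

theorem al_mul (X Y : (HD K D ⊗[K] HD K D) ⊗[K] HD K D) : al K (X * Y) = al K X * al K Y :=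
  map_mul (Algebra.TensorProduct.assoc K K K (HD K D) (HD K D) (HD K D)) X Y

theorem rT_mul (c : K) (f g : HD K D →ₗ[K] HD K D ⊗[K] HD K D)
    (hf : ∀ x y, f (x * y) = coprod K x * f y + (c * counit K y) • g x)
    (X Y : HD K D ⊗[K] HD K D) :
    f.rTensor _ (X * Y) = (coprod K (D := D)).toLinearMap.rTensor _ X * f.rTensor _ Y +
      c • (g.rTensor _ X * (1 ⊗ₜ[K] e2 K Y)) := by
  induction X using TensorProduct.induction_on with
  | zero => simp
  | add X X' h h' => simp only [map_add, add_mul, h, h', smul_add]; abel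
  | tmul a' b' =>
    induction Y using TensorProduct.induction_on with
    | zero => simp
    | add Y Y' h h' => simp only [map_add, mul_add, h, h', smul_add, tmul_add]; abel
    | tmul a'' b'' =>
      simp only [Algebra.TensorProduct.tmul_mul_tmul, LinearMap.rTensor_tmul, hf, e2_tmul, add_tmul,
        AlgHom.toLinearMap_apply, mul_smul, mul_one, tmul_smul, mul_smul_comm, ← smul_tmul']

theorem lT_mul (c : K) (f g : HD K D →ₗ[K] HD K D ⊗[K] HD K D)
    (hf : ∀ x y, f (x * y) = coprod K x * f y + (c * counit K y) • g x)
    (X Y : HD K D ⊗[K] HD K D) :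
    f.lTensor _ (X * Y) = (coprod K (D := D)).toLinearMap.lTensor _ X * f.lTensor _ Y +
      c • (g.lTensor _ X * (e1 K Y ⊗ₜ[K] 1)) := by
  induction X using TensorProduct.induction_on with
  | zero => simp
  | add X X' h h' => simp only [map_add, add_mul, h, h', smul_add]; abel
  | tmul a' b' =>
    induction Y using TensorProduct.induction_on with
    | zero => simp
    | add Y Y' h h' => simp only [map_add, mul_add, h, h', smul_add, add_tmul]; abel
    | tmul a'' b'' =>
      simp only [Algebra.TensorProduct.tmul_mul_tmul, LinearMap.lTensor_tmul, hf, e1_tmul, tmul_add,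
        AlgHom.toLinearMap_apply, mul_smul, mul_one, tmul_smul, mul_smul_comm, ← smul_tmul']

theorem lT_graft (d : D) (f : HD K D →ₗ[K] HD K D ⊗[K] HD K D)
    (hf : ∀ x, f (graft K d x) = (graft K d).lTensor _ (f x) + graft K d x ⊗ₜ[K] 1)
    (X : HD K D ⊗[K] HD K D) :
    f.lTensor _ ((graft K d).lTensor _ X) =
      ((graft K d).lTensor _).lTensor _ (f.lTensor _ X) +
        al K ((graft K d).lTensor _ X ⊗ₜ[K] 1) := by
  induction X using TensorProduct.induction_on with
  | zero => simp
  | add X X' h h' => simp only [map_add, add_tmul, h, h']; abel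
  | tmul a b => simp [hf, tmul_add, al_tmul]

theorem rT_graft (d : D) (f : HD K D →ₗ[K] HD K D ⊗[K] HD K D) (X : HD K D ⊗[K] HD K D) :
    al K (f.rTensor _ ((graft K d).lTensor _ X)) =
      ((graft K d).lTensor _).lTensor _ (al K (f.rTensor _ X)) := by
  induction X using TensorProduct.induction_on with
  | zero => simp
  | add X X' h h' => simp only [map_add, h, h']
  | tmul a b =>
    simp only [LinearMap.lTensor_tmul, LinearMap.rTensor_tmul]
    induction f a using TensorProduct.induction_on with
    | zero => simp
    | add X X' h h' => simp only [map_add, add_tmul, h, h']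
    | tmul a b => simp [al_tmul]

theorem coprod_mul' (x y : HD K D) : (coprod K (D := D)).toLinearMap (x * y) =
    coprod K x * (coprod K (D := D)).toLinearMap y + ((0 : K) * counit K y) • (0 : _ →ₗ[K] _) x := by
  simp

theorem rcoprod_mul' (x y : HD K D) : rcoprod K (x * y) =
    coprod K x * rcoprod K y + ((1 : K) * counit K y) • rcoprod K x := by
  rw [rcoprod_mul]; simp

theorem lcoprod_mul' (x y : HD K D) : lcoprod K (x * y) =
    coprod K x * lcoprod K y + ((-1 : K) * counit K y) • rcoprod K x := by
  rw [lcoprod_mul, neg_mul, one_mul, neg_smul, sub_eq_add_neg]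

theorem coprod_coassoc (x : HD K D) :
    al K ((coprod K (D := D)).toLinearMap.rTensor _ (coprod K x)) =
      (coprod K (D := D)).toLinearMap.lTensor _ (coprod K x) := by
  refine hd_induction K
    (f := (al K).toLinearMap ∘ₗ (coprod K (D := D)).toLinearMap.rTensor _ ∘ₗ (coprod K (D := D)).toLinearMap)
    (g := (coprod K (D := D)).toLinearMap.lTensor _ ∘ₗ (coprod K (D := D)).toLinearMap) ?_ ?_ x
  · simp [Algebra.TensorProduct.one_def, al_tmul]
  · intro d x y hx hy
    simp only [LinearMap.coe_comp, Function.comp_apply, AlgHom.toLinearMap_apply,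
      LinearEquiv.coe_coe] at hx hy ⊢
    have ht : al K ((coprod K (D := D)).toLinearMap.rTensor _ (coprod K (graft K d x))) =
        (coprod K (D := D)).toLinearMap.lTensor _ (coprod K (graft K d x)) := by
      nth_rewrite 2 [coprod_graft]
      nth_rewrite 1 [coprod_graft]
      rw [map_add, map_add, map_add, rT_graft, lT_graft K d _ (coprod_graft K d), hx]
      simp [coprod_graft, add_tmul, al_tmul, Algebra.TensorProduct.one_def, add_assoc]
    rw [map_mul, rT_mul K 0 _ 0 (coprod_mul' K), lT_mul K 0 _ 0 (coprod_mul' K), zero_smul,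
      zero_smul, add_zero, add_zero, al_mul, ht, hy]

theorem rcoprod_rcoprod (x : HD K D) :
    al K ((rcoprod K).rTensor _ (rcoprod K x)) =
      (coprod K (D := D)).toLinearMap.lTensor _ (rcoprod K x) := by
  refine hd_induction K
    (f := (al K).toLinearMap ∘ₗ (rcoprod K).rTensor _ ∘ₗ (rcoprod K))
    (g := (coprod K (D := D)).toLinearMap.lTensor _ ∘ₗ (rcoprod K)) ?_ ?_ x
  · simp [rcoprod_one]
  · intro d x y hx hy
    simp only [LinearMap.coe_comp, Function.comp_apply,
      LinearEquiv.coe_coe] at hx hy ⊢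
    have ht : al K ((rcoprod K).rTensor _ (rcoprod K (graft K d x))) =
        (coprod K (D := D)).toLinearMap.lTensor _ (rcoprod K (graft K d x)) := by
      nth_rewrite 2 [rcoprod_graft]
      nth_rewrite 1 [rcoprod_graft]
      rw [map_add, map_add, map_add, rT_graft, lT_graft K d _ (coprod_graft K d), hx]
      simp [rcoprod_graft, add_tmul, al_tmul, Algebra.TensorProduct.one_def, add_assoc]
    rw [rcoprod_mul, map_add, map_add, map_add, rT_mul K 1 _ _ (rcoprod_mul' K),
      lT_mul K 0 _ 0 (coprod_mul' K), e2_rcoprod, zero_smul, one_smul, tmul_zero, mul_zero,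
      add_zero, add_zero, al_mul, coprod_coassoc, hy, map_smul, map_smul, map_smul, ht]

theorem lcoprod_rcoprod (x : HD K D) :
    al K ((lcoprod K).rTensor _ (rcoprod K x)) = (rcoprod K).lTensor _ (lcoprod K x) := by
  refine hd_induction K
    (f := (al K).toLinearMap ∘ₗ (lcoprod K).rTensor _ ∘ₗ (rcoprod K))
    (g := (rcoprod K).lTensor _ ∘ₗ (lcoprod K)) ?_ ?_ x
  · simp [rcoprod_one, lcoprod_one, Algebra.TensorProduct.one_def]
  · intro d x y hx hy
    simp only [LinearMap.coe_comp, Function.comp_apply,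
      LinearEquiv.coe_coe] at hx hy ⊢
    have ht : al K ((lcoprod K).rTensor _ (rcoprod K (graft K d x))) =
        (rcoprod K).lTensor _ (lcoprod K (graft K d x)) := by
      rw [lcoprod_graft, rcoprod_graft, map_add, map_add, rT_graft,
        lT_graft K d _ (rcoprod_graft K d), hx]
      simp [lcoprod_graft]
    have ht' := ht
    nth_rewrite 1 [lcoprod_apply] at ht'
    rw [map_sub] at ht'
    rw [rcoprod_mul, lcoprod_mul, map_add, map_add, map_sub, rT_mul K (-1) _ _ (lcoprod_mul' K),
      lT_mul K 1 _ _ (rcoprod_mul' K), e2_rcoprod, one_smul, tmul_zero, mul_zero, smul_zero,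
      add_zero, al_mul, coprod_coassoc, hy, map_smul, map_smul, map_smul, ht', e1_lcoprod]
    rw [← smul_tmul', ← Algebra.TensorProduct.one_def, mul_smul_comm, mul_one, smul_sub]
    abel

theorem lcoprod_lcoprod (x : HD K D) :
    al K ((coprod K (D := D)).toLinearMap.rTensor _ (lcoprod K x)) =
      (lcoprod K).lTensor _ (lcoprod K x) := by
  have e : (coprod K (D := D)).toLinearMap = rcoprod K + lcoprod K := by
    rw [lcoprod]; abel
  have h1 := coprod_coassoc K x
  have h2 := rcoprod_rcoprod K x
  have h3 := lcoprod_rcoprod K x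
  have e' : coprod K x = rcoprod K x + lcoprod K x := by rw [lcoprod_apply]; abel
  rw [e', e] at h1
  rw [e] at h2 ⊢
  simp only [LinearMap.rTensor_add, LinearMap.lTensor_add, map_add, LinearMap.add_apply] at *
  rw [h2, h3] at h1
  have := congr($h1 - ((rcoprod K).lTensor _ (rcoprod K x) + (lcoprod K).lTensor _ (rcoprod K x)
    + (rcoprod K).lTensor _ (lcoprod K x)))
  convert this using 1 <;> abel

/-- The augmentation ideal, spanned by the nonempty forests. -/
abbrev AD (K D : Type*) [Field K] : Type _ :=
  LinearMap.ker (counit K (D := D)).toLinearMap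

/-- The inclusion of the augmentation ideal. -/
noncomputable def incl : AD K D →ₗ[K] HD K D :=
  Submodule.subtype _

/-- The projection on the augmentation ideal along the line spanned by `1`. -/
noncomputable def proj : HD K D →ₗ[K] AD K D :=
  LinearMap.codRestrict _
    (LinearMap.id - (LinearMap.toSpanSingleton K _ 1) ∘ₗ (counit K).toLinearMap)
    (fun x => by simp)

theorem incl_proj (x : HD K D) : incl K (proj K x) = x - counit K x • 1 := rfl

theorem counit_incl (a : AD K D) : counit K (incl K a) = 0 := a.2

theorem proj_incl (a : AD K D) : proj K (incl K a) = a := by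
  apply Subtype.ext
  change incl K (proj K (incl K a)) = incl K a
  rw [incl_proj, counit_incl, zero_smul, sub_zero]

/-- The left product of the augmentation ideal; the projection only restricts the codomain, as
`x ≺ y` always has counit `0`. -/
noncomputable def aprec : AD K D →ₗ[K] AD K D →ₗ[K] AD K D :=
  ((hprec K).compl₁₂ (incl K) (incl K)).compr₂ (proj K)

/-- The right product of the augmentation ideal, so that `a ≺ b + a ≻ b` is the product of the
free algebra. -/
noncomputable def asucc : AD K D →ₗ[K] AD K D →ₗ[K] AD K D :=
  ((hsucc K).compl₁₂ (incl K) (incl K)).compr₂ (proj K)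

/-- The left coproduct of the augmentation ideal `A`: on a nonempty forest `F` it is the sum of
`P^c(F) ⊗ R^c(F)` over the cuts `c` that cut the last tree totally or cut an edge of the path from
the root of the last tree to the rightmost leaf, the total cut of `F` (the only one with a component
outside `A ⊗ A`, namely `F ⊗ 1`) being left out. -/
noncomputable def acoprec : AD K D →ₗ[K] AD K D ⊗[K] AD K D :=
  TensorProduct.map (proj K) (proj K) ∘ₗ rcoprod K ∘ₗ incl K

/-- The right coproduct of the augmentation ideal: the sum over all other cuts except the empty
one. -/
noncomputable def acosucc : AD K D →ₗ[K] AD K D ⊗[K] AD K D :=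
  TensorProduct.map (proj K) (proj K) ∘ₗ lcoprod K ∘ₗ incl K

theorem incl_aprec (a b : AD K D) : incl K (aprec K a b) = hprec K (incl K a) (incl K b) := by
  change incl K (proj K (hprec K (incl K a) (incl K b))) = _
  rw [incl_proj, counit_hprec, zero_smul, sub_zero]

theorem incl_asucc (a b : AD K D) : incl K (asucc K a b) = hsucc K (incl K a) (incl K b) := by
  change incl K (proj K (hsucc K (incl K a) (incl K b))) = _
  rw [incl_proj, counit_hsucc, counit_incl, zero_mul, zero_smul, sub_zero]

theorem incl_injective : Function.Injective (incl K (D := D)) := Subtype.val_injective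

noncomputable instance instDendriformAlgebra : DendriformAlgebra K (AD K D) where
  prec := aprec K
  succ := asucc K
  prec_prec a b c := by
    apply incl_injective
    simp only [incl_aprec, incl_asucc, map_add, hprec_hprec, hsucc_apply, map_sub]
    abel
  succ_prec a b c := by
    apply incl_injective
    simp only [incl_aprec, incl_asucc, hsucc_hprec]
  succ_succ a b c := by
    apply incl_injective
    have h := hsucc_hprec K (incl K a) (incl K b) (incl K c)
    simp only [map_add, LinearMap.add_apply, incl_aprec, incl_asucc]
    simp only [hsucc_apply, map_sub, LinearMap.sub_apply, hprec_hprec, mul_assoc] at h ⊢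
    rw [← sub_eq_zero] at h ⊢
    rw [← neg_eq_zero, ← h]
    abel

/-- The inclusion of tensor squares. -/
noncomputable def incl₂ : AD K D ⊗[K] AD K D →ₗ[K] HD K D ⊗[K] HD K D :=
  TensorProduct.map (incl K) (incl K)

theorem incl₂_injective : Function.Injective (incl₂ K (D := D)) :=
  Function.LeftInverse.injective (g := TensorProduct.map (proj K) (proj K)) fun X => by
    induction X using TensorProduct.induction_on with
    | zero => simp
    | add X X' h h' => simp only [map_add, h, h']
    | tmul a b => simp [incl₂, proj_incl]

theorem incl₂_proj (X : HD K D ⊗[K] HD K D) :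
    incl₂ K (TensorProduct.map (proj K) (proj K) X) =
      X - e1 K X ⊗ₜ[K] 1 - 1 ⊗ₜ[K] e2 K X + counit K (e1 K X) • 1 := by
  induction X using TensorProduct.induction_on with
  | zero => simp
  | add X X' h h' => simp only [map_add, h, h', add_tmul, tmul_add, add_smul]; abel
  | tmul a b =>
    simp [incl₂, incl_proj, e1_tmul, e2_tmul, tmul_sub, sub_tmul, Algebra.TensorProduct.one_def,
      smul_tmul, mul_comm, smul_sub, mul_smul]
    rw [smul_comm (counit K a) (counit K b)]
    abel

/-- The left reduced coproduct on the whole algebra. -/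
noncomputable def rr : HD K D →ₗ[K] HD K D ⊗[K] HD K D :=
  rcoprod K - (TensorProduct.mk K _ _).flip 1

/-- The right reduced coproduct on the whole algebra. -/
noncomputable def ll : HD K D →ₗ[K] HD K D ⊗[K] HD K D :=
  lcoprod K - TensorProduct.mk K _ _ 1

theorem rr_apply (x : HD K D) : rr K x = rcoprod K x - x ⊗ₜ[K] 1 := rfl
theorem ll_apply (x : HD K D) : ll K x = lcoprod K x - 1 ⊗ₜ[K] x := rfl

theorem incl₂_acoprec (a : AD K D) : incl₂ K (acoprec K a) = rr K (incl K a) := by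
  change incl₂ K (TensorProduct.map (proj K) (proj K) (rcoprod K (incl K a))) = _
  rw [incl₂_proj, e1_rcoprod, e2_rcoprod, rr_apply]
  simp [counit_incl]

theorem incl₂_acosucc (a : AD K D) : incl₂ K (acosucc K a) = ll K (incl K a) := by
  change incl₂ K (TensorProduct.map (proj K) (proj K) (lcoprod K (incl K a))) = _
  rw [incl₂_proj, e1_lcoprod, e2_lcoprod, ll_apply]
  simp [counit_incl]

/-- The inclusion of tensor cubes. -/
noncomputable def incl₃ :
    AD K D ⊗[K] (AD K D ⊗[K] AD K D) →ₗ[K] HD K D ⊗[K] (HD K D ⊗[K] HD K D) :=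
  TensorProduct.map (incl K) (incl₂ K)

theorem incl₃_injective : Function.Injective (incl₃ K (D := D)) :=
  Function.LeftInverse.injective
    (g := TensorProduct.map (proj K) (TensorProduct.map (proj K) (proj K))) fun X => by
    induction X using TensorProduct.induction_on with
    | zero => simp
    | add X X' h h' => simp only [map_add, h, h']
    | tmul a b =>
      simp only [incl₃, TensorProduct.map_tmul, proj_incl]
      congr 1
      induction b using TensorProduct.induction_on with
      | zero => simp
      | add X X' h h' => simp only [map_add, h, h']
      | tmul a b => simp [incl₂, proj_incl]

theorem incl₃_assoc (X : AD K D ⊗[K] AD K D) (a : AD K D) :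
    incl₃ K (TensorProduct.assoc K _ _ _ (X ⊗ₜ[K] a)) = al K (incl₂ K X ⊗ₜ[K] incl K a) := by
  induction X using TensorProduct.induction_on with
  | zero => simp
  | add X X' h h' => simp only [map_add, add_tmul, h, h']
  | tmul a b => simp [incl₃, incl₂, al_tmul]

theorem incl₃_rT (f : AD K D →ₗ[K] AD K D ⊗[K] AD K D) (g : HD K D →ₗ[K] HD K D ⊗[K] HD K D)
    (h : ∀ a, incl₂ K (f a) = g (incl K a)) (X : AD K D ⊗[K] AD K D) :
    incl₃ K (TensorProduct.assoc K _ _ _ (f.rTensor _ X)) = al K (g.rTensor _ (incl₂ K X)) := by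
  induction X using TensorProduct.induction_on with
  | zero => simp
  | add X X' h h' => simp only [map_add, h, h']
  | tmul a b => rw [LinearMap.rTensor_tmul, incl₃_assoc, h]; simp [incl₂]

theorem incl₃_lT (f : AD K D →ₗ[K] AD K D ⊗[K] AD K D) (g : HD K D →ₗ[K] HD K D ⊗[K] HD K D)
    (h : ∀ a, incl₂ K (f a) = g (incl K a)) (X : AD K D ⊗[K] AD K D) :
    incl₃ K (f.lTensor _ X) = g.lTensor _ (incl₂ K X) := by
  induction X using TensorProduct.induction_on with
  | zero => simp
  | add X X' h h' => simp only [map_add, h, h']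
  | tmul a b => simp [incl₃, incl₂]; rw [← h]; rfl

theorem al_rT_one (X : HD K D ⊗[K] HD K D) :
    al K (((TensorProduct.mk K (HD K D) (HD K D)).flip 1).rTensor _ X) =
      (TensorProduct.mk K (HD K D) (HD K D) 1).lTensor _ X := by
  induction X using TensorProduct.induction_on with
  | zero => simp
  | add X X' h h' => simp only [map_add, h, h']
  | tmul a b => simp [al_tmul]

theorem lT_one (X : HD K D ⊗[K] HD K D) :
    ((TensorProduct.mk K (HD K D) (HD K D)).flip 1).lTensor _ X = al K (X ⊗ₜ[K] 1) := by
  induction X using TensorProduct.induction_on with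
  | zero => simp
  | add X X' h h' => simp only [map_add, add_tmul, h, h']
  | tmul a b => simp [al_tmul]

theorem al_rT_one' (X : HD K D ⊗[K] HD K D) :
    al K ((TensorProduct.mk K (HD K D) (HD K D) 1).rTensor _ X) = 1 ⊗ₜ[K] X := by
  induction X using TensorProduct.induction_on with
  | zero => simp
  | add X X' h h' => simp only [map_add, tmul_add, h, h']
  | tmul a b => simp [al_tmul]

theorem rr_add_ll : rr K + ll K = (coprod K (D := D)).toLinearMap -
    (TensorProduct.mk K _ _).flip 1 - TensorProduct.mk K _ _ 1 := by
  rw [rr, ll, lcoprod]; abel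

theorem rr_rr (x : HD K D) :
    al K ((rr K).rTensor _ (rr K x)) = (rr K + ll K).lTensor _ (rr K x) := by
  have h := rcoprod_rcoprod K x
  rw [rr_add_ll, rr_apply, rr]
  simp only [LinearMap.rTensor_sub, LinearMap.lTensor_sub, map_sub, LinearMap.sub_apply, h,
    al_rT_one, lT_one]
  simp [al_tmul, Algebra.TensorProduct.one_def]
  abel

theorem ll_rr (x : HD K D) :
    al K ((ll K).rTensor _ (rr K x)) = (rr K).lTensor _ (ll K x) := by
  have h := lcoprod_rcoprod K x
  rw [rr_apply, ll_apply, ll, rr]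
  simp only [LinearMap.rTensor_sub, LinearMap.lTensor_sub, map_sub, LinearMap.sub_apply, h,
    al_rT_one', lT_one]
  simp [al_tmul]
  abel

theorem ll_ll (x : HD K D) :
    al K ((rr K + ll K).rTensor _ (ll K x)) = (ll K).lTensor _ (ll K x) := by
  have h := lcoprod_lcoprod K x
  rw [rr_add_ll, ll_apply, ll]
  simp only [LinearMap.rTensor_sub, LinearMap.lTensor_sub, map_sub, LinearMap.sub_apply, h,
    al_rT_one, al_rT_one']
  simp [al_tmul, Algebra.TensorProduct.one_def]
  abel

noncomputable instance instDendriformCoalgebra : DendriformCoalgebra K (AD K D) where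
  coprec := acoprec K
  cosucc := acosucc K
  coprec_coprec a := by
    apply incl₃_injective
    rw [incl₃_rT K _ _ (incl₂_acoprec K), incl₃_lT K _ (rr K + ll K), incl₂_acoprec, rr_rr]
    intro a
    rw [LinearMap.add_apply, map_add, incl₂_acoprec, incl₂_acosucc]; rfl
  cosucc_coprec a := by
    apply incl₃_injective
    rw [incl₃_rT K _ _ (incl₂_acosucc K), incl₃_lT K _ _ (incl₂_acoprec K), incl₂_acoprec,
      incl₂_acosucc, ll_rr]
  cosucc_cosucc a := by
    apply incl₃_injective
    rw [incl₃_rT K _ (rr K + ll K), incl₃_lT K _ _ (incl₂_acosucc K), incl₂_acosucc, ll_ll]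
    intro a
    rw [LinearMap.add_apply, map_add, incl₂_acoprec, incl₂_acosucc]; rfl

theorem incl_dmul (a b : AD K D) : incl K (dmul K a b) = incl K a * incl K b := by
  change incl K (aprec K a b + asucc K a b) = _
  rw [map_add, incl_aprec, incl_asucc, hsucc_apply]; abel

/-- The reduced coproduct on the whole algebra. -/
noncomputable def rd : HD K D →ₗ[K] HD K D ⊗[K] HD K D := rr K + ll K

theorem coprod_eq (x : HD K D) : coprod K x = rd K x + x ⊗ₜ[K] 1 + 1 ⊗ₜ[K] x := by
  rw [rd, rr_add_ll]; simp; abel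

theorem incl₂_redCoprod (a : AD K D) : incl₂ K (redCoprod K a) = rd K (incl K a) := by
  change incl₂ K (acoprec K a + acosucc K a) = _
  rw [map_add, incl₂_acoprec, incl₂_acosucc]; rfl

theorem incl₂_map₂ (f g : AD K D →ₗ[K] AD K D →ₗ[K] AD K D)
    (f' g' : HD K D →ₗ[K] HD K D →ₗ[K] HD K D)
    (hf : ∀ a b, incl K (f a b) = f' (incl K a) (incl K b))
    (hg : ∀ a b, incl K (g a b) = g' (incl K a) (incl K b)) (X Y : AD K D ⊗[K] AD K D) :
    incl₂ K (map₂ f g X Y) = map₂ f' g' (incl₂ K X) (incl₂ K Y) := by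
  induction X using TensorProduct.induction_on with
  | zero => simp
  | add X X' h h' => simp only [map_add, LinearMap.add_apply, h, h']
  | tmul a b =>
    induction Y using TensorProduct.induction_on with
    | zero => simp
    | add Y Y' h h' => simp only [map_add, h, h']
    | tmul c d => simp [map₂_apply_tmul, incl₂, hf, hg]

theorem incl₂_lTensor (f : AD K D →ₗ[K] AD K D) (f' : HD K D →ₗ[K] HD K D)
    (hf : ∀ a, incl K (f a) = f' (incl K a)) (X : AD K D ⊗[K] AD K D) :
    incl₂ K (f.lTensor _ X) = f'.lTensor _ (incl₂ K X) := by
  induction X using TensorProduct.induction_on with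
  | zero => simp
  | add X X' h h' => simp only [map_add, h, h']
  | tmul a b => simp [incl₂, hf]

theorem incl₂_rTensor (f : AD K D →ₗ[K] AD K D) (f' : HD K D →ₗ[K] HD K D)
    (hf : ∀ a, incl K (f a) = f' (incl K a)) (X : AD K D ⊗[K] AD K D) :
    incl₂ K (f.rTensor _ X) = f'.rTensor _ (incl₂ K X) := by
  induction X using TensorProduct.induction_on with
  | zero => simp
  | add X X' h h' => simp only [map_add, h, h']
  | tmul a b => simp [incl₂, hf]

theorem map₂_tmul_one (m : HD K D →ₗ[K] HD K D →ₗ[K] HD K D) (a : HD K D)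
    (Y : HD K D ⊗[K] HD K D) :
    map₂ (LinearMap.mul K _) m (a ⊗ₜ[K] 1) Y =
      (LinearMap.mulLeft K a).rTensor _ ((m 1).lTensor _ Y) := by
  induction Y using TensorProduct.induction_on with
  | zero => simp
  | add Y Y' h h' => simp only [map_add, h, h']
  | tmul c d => simp [map₂_apply_tmul]

theorem map₂_one_tmul (m : HD K D →ₗ[K] HD K D →ₗ[K] HD K D) (a : HD K D)
    (Y : HD K D ⊗[K] HD K D) :
    map₂ (LinearMap.mul K _) m (1 ⊗ₜ[K] a) Y = (m a).lTensor _ Y := by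
  induction Y using TensorProduct.induction_on with
  | zero => simp
  | add Y Y' h h' => simp only [map_add, h, h']
  | tmul c d => simp [map₂_apply_tmul]

theorem map₂_tmul_one_right (m : HD K D →ₗ[K] HD K D →ₗ[K] HD K D) (b : HD K D)
    (X : HD K D ⊗[K] HD K D) :
    map₂ (LinearMap.mul K _) m X (b ⊗ₜ[K] 1) =
      (LinearMap.mulRight K b).rTensor _ ((m.flip 1).lTensor _ X) := by
  induction X using TensorProduct.induction_on with
  | zero => simp
  | add Y Y' h h' => simp only [map_add, LinearMap.add_apply, h, h']
  | tmul c d => simp [map₂_apply_tmul]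

theorem map₂_one_tmul_right (m : HD K D →ₗ[K] HD K D →ₗ[K] HD K D) (b : HD K D)
    (X : HD K D ⊗[K] HD K D) :
    map₂ (LinearMap.mul K _) m X (1 ⊗ₜ[K] b) = (m.flip b).lTensor _ X := by
  induction X using TensorProduct.induction_on with
  | zero => simp
  | add Y Y' h h' => simp only [map_add, LinearMap.add_apply, h, h']
  | tmul c d => simp [map₂_apply_tmul]

theorem hprec_one' : hprec K (1 : HD K D) = 0 := LinearMap.ext (hprec_one K)

theorem hsucc_one' : hsucc K (1 : HD K D) = LinearMap.id :=
  LinearMap.ext fun x => by simp [hsucc_apply, hprec_one]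

theorem lT_hsucc_one (X : HD K D ⊗[K] HD K D) :
    ((hsucc K).flip 1).lTensor _ X = e1 K X ⊗ₜ[K] 1 := by
  induction X using TensorProduct.induction_on with
  | zero => simp
  | add Y Y' h h' => simp only [map_add, add_tmul, h, h']
  | tmul c d => simp [hsucc_one_right, e1_tmul, smul_tmul]

theorem e1_rd (x : HD K D) (hx : counit K x = 0) : e1 K (rd K x) = 0 := by
  have := e1_coprod K x
  rw [coprod_eq] at this
  simpa [e1_tmul, hx] using this

theorem lT_hprec_one (X : HD K D ⊗[K] HD K D) :
    ((hprec K).flip 1).lTensor _ X = X - e1 K X ⊗ₜ[K] 1 := by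
  induction X using TensorProduct.induction_on with
  | zero => simp
  | add Y Y' h h' => simp only [map_add, add_tmul, h, h']; abel
  | tmul c d => simp [hprec_one_right, e1_tmul, smul_tmul, tmul_sub]

theorem ll_hsucc (a b : HD K D) (hb : counit K b = 0) :
    ll K (hsucc K a b) = map₂ (LinearMap.mul K _) (hsucc K) (rd K a) (ll K b)
      + ((hsucc K).flip b).lTensor _ (rd K a) + (hsucc K a).lTensor _ (ll K b)
      + (LinearMap.mulLeft K a).rTensor _ (ll K b) + a ⊗ₜ[K] b := by
  have e : lcoprod K b = ll K b + 1 ⊗ₜ[K] b := by rw [ll_apply]; abel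
  rw [ll_apply, lcoprod_hsucc K a b hb, coprod_eq, e]
  simp only [map_add, LinearMap.add_apply, map₂_one_tmul, map₂_tmul_one, map₂_one_tmul_right,
    hsucc_one', LinearMap.lTensor_id, LinearMap.id_apply]
  simp [hsucc_one']
  abel

theorem ll_hprec (a b : HD K D) (hb : counit K b = 0) :
    ll K (hprec K a b) = map₂ (LinearMap.mul K _) (hprec K) (rd K a) (ll K b)
      + ((hprec K).flip b).lTensor _ (rd K a) + (hprec K a).lTensor _ (ll K b) := by
  have e : lcoprod K b = ll K b + 1 ⊗ₜ[K] b := by rw [ll_apply]; abel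
  rw [ll_apply, lcoprod_hprec K a b hb, coprod_eq, e]
  simp only [map_add, LinearMap.add_apply, map₂_one_tmul, map₂_tmul_one, map₂_one_tmul_right,
    hprec_one', LinearMap.lTensor_zero, LinearMap.zero_apply]
  simp [hprec_one']
  abel

theorem rr_hprec (a b : HD K D) (ha : counit K a = 0) (hb : counit K b = 0) :
    rr K (hprec K a b) = map₂ (LinearMap.mul K _) (hprec K) (rd K a) (rr K b)
      + (LinearMap.mulRight K b).rTensor _ (rd K a) + (hprec K a).lTensor _ (rr K b)
      + b ⊗ₜ[K] a := by
  have e : rcoprod K b = rr K b + b ⊗ₜ[K] 1 := by rw [rr_apply]; abel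
  rw [rr_apply, rcoprod_hprec K a b hb, coprod_eq, e]
  simp only [map_add, LinearMap.add_apply, map₂_one_tmul, map₂_tmul_one, map₂_tmul_one_right,
    hprec_one', LinearMap.lTensor_zero, LinearMap.zero_apply, lT_hprec_one, e1_rd K a ha]
  simp [e1_tmul, ha]
  abel

theorem rr_hsucc (a b : HD K D) (ha : counit K a = 0) (hb : counit K b = 0) :
    rr K (hsucc K a b) = map₂ (LinearMap.mul K _) (hsucc K) (rd K a) (rr K b)
      + (LinearMap.mulLeft K a).rTensor _ (rr K b) + (hsucc K a).lTensor _ (rr K b) := by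
  have e : rcoprod K b = rr K b + b ⊗ₜ[K] 1 := by rw [rr_apply]; abel
  rw [rr_apply, rcoprod_hsucc K a b hb, coprod_eq, e]
  simp only [map_add, LinearMap.add_apply, map₂_one_tmul, map₂_tmul_one, map₂_tmul_one_right,
    hsucc_one', LinearMap.lTensor_id, LinearMap.id_apply, lT_hsucc_one, e1_rd K a ha]
  simp [e1_tmul, ha, hsucc_apply, sub_tmul]

/-- The bidendriform bialgebra of planar decorated rooted forests. Its product is that of the free
algebra (`incl_dmul`), its coproduct is the reduced coproduct of the Hopf algebra
(`incl₂_redCoprod`, `coprod_eq`), `vertex d ≺ x` is the grafting of `x` on a root decorated by `d`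
(`aprec_vertex`), and both coproducts vanish on the trees with one vertex (`acoprec_vertex`,
`acosucc_vertex`). -/
noncomputable instance instBidendriformBialgebra : BidendriformBialgebra K (AD K D) where
  cosucc_succ a b := by
    apply incl₂_injective
    change incl₂ K (acosucc K (asucc K a b)) =
      incl₂ K (map₂ (dmul K) (asucc K) (redCoprod K a) (acosucc K b)
        + ((asucc K).flip b).lTensor _ (redCoprod K a) + (asucc K a).lTensor _ (acosucc K b)
        + (dmul K a).rTensor _ (acosucc K b) + a ⊗ₜ[K] b)
    rw [map_add, map_add, map_add, map_add, incl₂_acosucc, incl_asucc,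
      incl₂_map₂ K _ _ (LinearMap.mul K _) (hsucc K) (incl_dmul K) (incl_asucc K),
      incl₂_lTensor K _ ((hsucc K).flip (incl K b)) (fun a => incl_asucc K a b),
      incl₂_lTensor K _ (hsucc K (incl K a)) (fun b => incl_asucc K a b),
      incl₂_rTensor K _ (LinearMap.mulLeft K (incl K a)) (fun b => incl_dmul K a b),
      incl₂_acosucc, incl₂_redCoprod, ll_hsucc K _ _ (counit_incl K b)]
    rfl
  cosucc_prec a b := by
    apply incl₂_injective
    change incl₂ K (acosucc K (aprec K a b)) =
      incl₂ K (map₂ (dmul K) (aprec K) (redCoprod K a) (acosucc K b)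
        + ((aprec K).flip b).lTensor _ (redCoprod K a) + (aprec K a).lTensor _ (acosucc K b))
    rw [map_add, map_add, incl₂_acosucc, incl_aprec,
      incl₂_map₂ K _ _ (LinearMap.mul K _) (hprec K) (incl_dmul K) (incl_aprec K),
      incl₂_lTensor K _ ((hprec K).flip (incl K b)) (fun a => incl_aprec K a b),
      incl₂_lTensor K _ (hprec K (incl K a)) (fun b => incl_aprec K a b),
      incl₂_acosucc, incl₂_redCoprod, ll_hprec K _ _ (counit_incl K b)]
  coprec_succ a b := by
    apply incl₂_injective
    change incl₂ K (acoprec K (asucc K a b)) =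
      incl₂ K (map₂ (dmul K) (asucc K) (redCoprod K a) (acoprec K b)
        + (dmul K a).rTensor _ (acoprec K b) + (asucc K a).lTensor _ (acoprec K b))
    rw [map_add, map_add, incl₂_acoprec, incl_asucc,
      incl₂_map₂ K _ _ (LinearMap.mul K _) (hsucc K) (incl_dmul K) (incl_asucc K),
      incl₂_rTensor K _ (LinearMap.mulLeft K (incl K a)) (fun b => incl_dmul K a b),
      incl₂_lTensor K _ (hsucc K (incl K a)) (fun b => incl_asucc K a b),
      incl₂_acoprec, incl₂_redCoprod, rr_hsucc K _ _ (counit_incl K a) (counit_incl K b)]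
  coprec_prec a b := by
    apply incl₂_injective
    change incl₂ K (acoprec K (aprec K a b)) =
      incl₂ K (map₂ (dmul K) (aprec K) (redCoprod K a) (acoprec K b)
        + ((dmul K).flip b).rTensor _ (redCoprod K a) + (aprec K a).lTensor _ (acoprec K b)
        + b ⊗ₜ[K] a)
    rw [map_add, map_add, map_add, incl₂_acoprec, incl_aprec,
      incl₂_map₂ K _ _ (LinearMap.mul K _) (hprec K) (incl_dmul K) (incl_aprec K),
      incl₂_rTensor K _ (LinearMap.mulRight K (incl K b)) (fun a => incl_dmul K a b),
      incl₂_lTensor K _ (hprec K (incl K a)) (fun b => incl_aprec K a b),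
      incl₂_acoprec, incl₂_redCoprod, rr_hprec K _ _ (counit_incl K a) (counit_incl K b)]
    rfl

/-- The single-vertex tree decorated by `d`. -/
noncomputable def vertex (d : D) : AD K D :=
  ⟨tree K (PTree.node d []), by simp [counit, algLift_tree]⟩

theorem vertex_eq_graft (d : D) : incl K (vertex K d) = graft K d 1 := by
  rw [← mon_nil, graft_mon]; simp [mon, vertex, incl]

theorem acoprec_vertex (d : D) : acoprec K (vertex K d) = 0 := by
  apply incl₂_injective
  rw [incl₂_acoprec, vertex_eq_graft, rr_apply, rcoprod_graft, rcoprod_one]; simp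

theorem acosucc_vertex (d : D) : acosucc K (vertex K d) = 0 := by
  apply incl₂_injective
  rw [incl₂_acosucc, vertex_eq_graft, ll_apply, lcoprod_graft, lcoprod_one]
  simp [Algebra.TensorProduct.one_def]

theorem aprec_vertex (d : D) (a : AD K D) :
    incl K (aprec K (vertex K d) a) = graft K d (incl K a) := by
  rw [incl_aprec, vertex_eq_graft, hprec_graft, one_mul]
end Algebra
end Bidend

/-!
The augmentation ideal `A` is spanned by the vertices and the elements `a ≺ b`, `a ≻ b`: a forest
`t F` with `F ≠ 1` is `t ≺ F + t ≻ F`, and `B_d(F) = •_d ≺ F`. It therefore suffices to find a linear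
endomorphism of `A` that is the identity on totally primitive elements and vanishes on all `a ≺ b`
and `a ≻ b`: it then maps `A`, hence its fixed points, into the span of the vertices.

Such an endomorphism is the composite of two projections of the kind that occurs in the fundamental
theorem of Hopf modules. Let `S` and `T` be linear maps reversing products, with
`S(x') x'' = ε(x) = x'' T(x')`, where `x' ⊗ x''` is the full coproduct `Δ(x)`; they are the antipode
and its inverse (`exists_antipode`, `exists_skew_antipode`).

* `A` is a right module under `≺`, and `Δ(a ≺ b) = a' b' ⊗ (a'' ≺ b'') + (a ≺ b) ⊗ 1`. Hence
  `e(a) = a'' ≺ T(a')`, with `1 ≺ x = 0`, satisfies `e(a ≺ b) = ε(b) e(a)`.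
* `A` is a left module under `≻`, and with `Δ_l(b) = b' ⊗ b''` for the part `lcoprod` of the coproduct
  one has `Δ_l(a ≻ b) = a' b' ⊗ (a'' ≻ b'')`. Hence `φ(a) = S(a') ≻ a''`, the coproduct being `Δ_l`,
  vanishes on `a ≻ b`. As `(a ≻ b) ≺ c = a ≻ (b ≺ c)`, it maps `a ≺ b` to a sum of elements
  `u ≺ b''`, and those are killed by `e`.

So `e ∘ φ` vanishes on both kinds of products. On a totally primitive element `Δ_l(a) = 1 ⊗ a` and
`Δ(a) = a ⊗ 1 + 1 ⊗ a`, so that `φ(a) = 1 ≻ a = a` and `e(a) = a ≺ 1 = a`.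
-/

namespace Bidend

section Antipode

variable (K : Type*) {D : Type*} [Field K]

open TensorProduct MulOpposite

/-! ### Algebra morphisms defined by recursion on trees -/

section Recursion

variable {R : Type*} [Ring R] [Algebra K R] (β : D → R ⊗[K] HD K D →ₗ[K] R)

mutual
/-- The value of `(S ⊗ id) ∘ Δ` at a tree, where `S` is the algebra morphism with
`S(B_d(g)) = β_d ((S ⊗ id) Δ(g))`. -/
noncomputable def recTree : PTree D → R ⊗[K] HD K D
  | PTree.node d l =>
      (graft K d).lTensor R (recForest l) + β d (recForest l) ⊗ₜ[K] 1
/-- The value of `(S ⊗ id) ∘ Δ` at a forest. -/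
noncomputable def recForest : List (PTree D) → R ⊗[K] HD K D
  | [] => 1
  | t :: l => recTree t * recForest l
end

/-- The recursion calls `S` on the pruned parts of `g`, which are not subterms of `g`; so it is run on
`(S ⊗ id) ∘ Δ` instead, whose value at a tree depends only on its value at the forest above the
root. -/
theorem exists_algHom_graft :
    ∃ S : HD K D →ₐ[K] R, ∀ d g, S (graft K d g) =
      β d (Algebra.TensorProduct.map S (AlgHom.id K (HD K D)) (coprod K g)) := by
  let σ : PTree D → R := fun | PTree.node d l => β d (recForest K β l)
  let S : HD K D →ₐ[K] R := algLift K σ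
  have hS (t : PTree D) : S (mon K [t]) = σ t := by simp [S, mon, algLift_tree]
  have hnat (d : D) (X : HD K D ⊗[K] HD K D) :
      Algebra.TensorProduct.map S (AlgHom.id K (HD K D)) ((graft K d).lTensor _ X) =
        (graft K d).lTensor R (Algebra.TensorProduct.map S (AlgHom.id K (HD K D)) X) := by
    induction X using TensorProduct.induction_on with
    | zero => simp
    | add X X' h h' => simp only [map_add, h, h']
    | tmul a b => simp
  have hrec (l : List (PTree D)) :
      Algebra.TensorProduct.map S (AlgHom.id K (HD K D)) (coprod K (mon K l)) =
        recForest K β l := by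
    induction l using forest_induction with
    | nil => rw [mon_nil, map_one, map_one, recForest]
    | cons d l F hl hF =>
      rw [mon_cons, map_mul, map_mul, hF, recForest, recTree, ← graft_mon, coprod_graft, map_add,
        hnat, hl, graft_mon]
      simp [hS, σ]
  refine ⟨S, fun d g => hd_ext_apply K (f := S.toLinearMap ∘ₗ graft K d)
    (g := β d ∘ₗ (Algebra.TensorProduct.map S (AlgHom.id K (HD K D))).toLinearMap ∘ₗ
      (coprod K (D := D)).toLinearMap) (fun l => ?_) g⟩
  change S (graft K d (mon K l)) =
    β d (Algebra.TensorProduct.map S (AlgHom.id K (HD K D)) (coprod K (mon K l)))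
  rw [hrec, graft_mon, hS]

end Recursion

/-! ### The antipode and its inverse -/

/-- The linear map `x ⊗ y ↦ m(s(x), y)`. Evaluated at a coproduct, it is the convolution of `s` and
the identity when `m` is the product, and gives the two projections when `m` is `≻` or the opposite
of `≺`. -/
noncomputable def twistLift (m : HD K D →ₗ[K] HD K D →ₗ[K] HD K D) (s : HD K D →ₗ[K] HD K D) :
    HD K D ⊗[K] HD K D →ₗ[K] HD K D :=
  TensorProduct.lift (m ∘ₗ s)

theorem twistLift_tmul (m : HD K D →ₗ[K] HD K D →ₗ[K] HD K D) (s : HD K D →ₗ[K] HD K D)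
    (x y : HD K D) : twistLift K m s (x ⊗ₜ[K] y) = m (s x) y := rfl

/-- For every bilinear `m` with `m(x, 1) = x` there is an antimorphism `s` with
`m(s(x'), x'') = 0` for all trees `x`; the formula for the coproduct of a tree turns this condition
into a recursive definition of `s`. -/
theorem exists_antimorphism (m : HD K D →ₗ[K] HD K D →ₗ[K] HD K D)
    (hm : ∀ x, m x 1 = x) :
    ∃ s : HD K D →ₗ[K] HD K D, s 1 = 1 ∧ (∀ x y, s (x * y) = s y * s x) ∧
      ∀ d g, twistLift K m s (coprod K (graft K d g)) = 0 := by
  let u : (HD K D)ᵐᵒᵖ →ₗ[K] HD K D := (opLinearEquiv K).symm.toLinearMap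
  let β (d : D) : (HD K D)ᵐᵒᵖ ⊗[K] HD K D →ₗ[K] (HD K D)ᵐᵒᵖ :=
    -((opLinearEquiv K).toLinearMap ∘ₗ TensorProduct.lift (m ∘ₗ u) ∘ₗ (graft K d).lTensor _)
  obtain ⟨S, hS⟩ := exists_algHom_graft K β
  refine ⟨u ∘ₗ S.toLinearMap, by simp [u], fun x y => by simp [u], fun d g => ?_⟩
  have h (X : HD K D ⊗[K] HD K D) :
      unop (β d (Algebra.TensorProduct.map S (AlgHom.id K (HD K D)) X)) =
        -twistLift K m (u ∘ₗ S.toLinearMap) ((graft K d).lTensor _ X) := by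
    induction X using TensorProduct.induction_on with
    | zero => simp
    | add X X' h h' => simp only [map_add, unop_add, h, h']; abel
    | tmul a b => simp [β, twistLift_tmul]
  rw [coprod_graft, map_add, twistLift_tmul, hm]
  simp [u, hS, h]

/-- The antipode, normalised by `S(x') x'' = ε(x)`. -/
theorem exists_antipode : ∃ s : HD K D →ₗ[K] HD K D, s 1 = 1 ∧ (∀ x y, s (x * y) = s y * s x) ∧
    ∀ x, twistLift K (LinearMap.mul K _) s (coprod K x) = counit K x • 1 := by
  obtain ⟨s, h1, hs, hg⟩ := exists_antimorphism K (LinearMap.mul K (HD K D)) (by simp)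
  refine ⟨s, h1, hs, fun x => hd_induction K
    (f := twistLift K (LinearMap.mul K _) s ∘ₗ (coprod K (D := D)).toLinearMap)
    (g := LinearMap.toSpanSingleton K _ 1 ∘ₗ (counit K).toLinearMap) ?_ ?_ x⟩
  · simp [Algebra.TensorProduct.one_def, twistLift_tmul, h1]
  · intro d x y _ _
    have h (X Y : HD K D ⊗[K] HD K D) (hX : twistLift K (LinearMap.mul K _) s X = 0) :
        twistLift K (LinearMap.mul K _) s (X * Y) = 0 := by
      induction Y using TensorProduct.induction_on with
      | zero => simp
      | add Y Y' h h' => rw [mul_add, map_add, h, h', add_zero]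
      | tmul c d =>
        have : twistLift K (LinearMap.mul K _) s (X * c ⊗ₜ[K] d) =
            s c * twistLift K (LinearMap.mul K _) s X * d := by
          clear hX
          induction X using TensorProduct.induction_on with
          | zero => simp
          | add X X' h h' => simp only [add_mul, mul_add, map_add, h, h']
          | tmul a b => simp [twistLift_tmul, hs, mul_assoc]
        rw [this, hX, mul_zero, zero_mul]
    simp [h _ _ (hg d x), counit_graft]

/-- The inverse of the antipode, normalised by `x'' T(x') = ε(x)`. -/
theorem exists_skew_antipode :
    ∃ s : HD K D →ₗ[K] HD K D, s 1 = 1 ∧ (∀ x y, s (x * y) = s y * s x) ∧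
      ∀ x, twistLift K (LinearMap.mul K _).flip s (coprod K x) = counit K x • 1 := by
  obtain ⟨s, h1, hs, hg⟩ :=
    exists_antimorphism K (LinearMap.mul K (HD K D)).flip (by simp)
  refine ⟨s, h1, hs, fun x => hd_induction K
    (f := twistLift K (LinearMap.mul K _).flip s ∘ₗ (coprod K (D := D)).toLinearMap)
    (g := LinearMap.toSpanSingleton K _ 1 ∘ₗ (counit K).toLinearMap) ?_ ?_ x⟩
  · simp [Algebra.TensorProduct.one_def, twistLift_tmul, h1]
  · intro d x y _ hy
    replace hy : twistLift K (LinearMap.mul K _).flip s (coprod K y) = counit K y • 1 := hy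
    have h (X Y : HD K D ⊗[K] HD K D) (c : K)
        (hY : twistLift K (LinearMap.mul K _).flip s Y = c • 1) :
        twistLift K (LinearMap.mul K _).flip s (X * Y) =
          c • twistLift K (LinearMap.mul K _).flip s X := by
      induction X using TensorProduct.induction_on with
      | zero => simp
      | add X X' h h' => rw [add_mul, map_add, h, h', map_add, smul_add]
      | tmul a b =>
        have : twistLift K (LinearMap.mul K _).flip s (a ⊗ₜ[K] b * Y) =
            b * twistLift K (LinearMap.mul K _).flip s Y * s a := by
          clear hY
          induction Y using TensorProduct.induction_on with
          | zero => simp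
          | add X X' h h' => simp only [add_mul, mul_add, map_add, h, h']
          | tmul a b => simp [twistLift_tmul, hs, mul_assoc]
        rw [this, hY]
        simp [twistLift_tmul]
    simp [h _ _ _ hy, hg d x, counit_graft]

/-! ### The projections attached to the two module structures -/

theorem hsucc_hsucc (a b c : HD K D) : hsucc K a (hsucc K b c) = hsucc K (a * b) c := by
  have h := hsucc_hprec K a b c
  simp only [hsucc_apply, map_sub, LinearMap.sub_apply, hprec_hprec, mul_assoc] at h ⊢
  rw [← sub_eq_zero] at h ⊢
  rw [← h]
  abel

theorem coprod_hprec (a b : HD K D) (hb : counit K b = 0) :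
    coprod K (hprec K a b) =
      map₂ (LinearMap.mul K _) (hprec K) (coprod K a) (coprod K b) + hprec K a b ⊗ₜ[K] 1 := by
  have e (x : HD K D) : coprod K x = lcoprod K x + rcoprod K x := by rw [lcoprod_apply]; abel
  rw [e, lcoprod_hprec K a b hb, rcoprod_hprec K a b hb, e b, map_add, add_assoc]


section Projections

variable {K} {s : HD K D →ₗ[K] HD K D}

/-- On the coproduct of `u ≺ v` the map `e` gives `u'' ≺ (v'' T(v') T(u'))`; the term
`(u ≺ v) ⊗ 1` does not contribute, as `1 ≺ x = 0`. -/
theorem twistLift_hprec_coprod_hprec_of_counit (hs : ∀ x y, s (x * y) = s y * s x)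
    (hε : ∀ x, twistLift K (LinearMap.mul K _).flip s (coprod K x) = counit K x • 1)
    (u v : HD K D) (hv : counit K v = 0) :
    twistLift K (hprec K).flip s (coprod K (hprec K u v)) = 0 := by
  have h (X Y : HD K D ⊗[K] HD K D) (hY : twistLift K (LinearMap.mul K _).flip s Y = 0) :
      twistLift K (hprec K).flip s (map₂ (LinearMap.mul K _) (hprec K) X Y) = 0 := by
    induction X using TensorProduct.induction_on with
    | zero => simp
    | add X X' h h' => rw [map_add, LinearMap.add_apply, map_add, h, h', add_zero]
    | tmul a b =>
      have : twistLift K (hprec K).flip s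
          (map₂ (LinearMap.mul K _) (hprec K) (a ⊗ₜ[K] b) Y) =
            hprec K b (twistLift K (LinearMap.mul K _).flip s Y * s a) := by
        clear hY
        induction Y using TensorProduct.induction_on with
        | zero => simp
        | add X X' h h' => simp only [add_mul, map_add, h, h']
        | tmul c d => simp [twistLift_tmul, map₂_apply_tmul, hs, hprec_hprec, mul_assoc]
      rw [this, hY, zero_mul, map_zero]
  rw [coprod_hprec K u v hv, map_add, h _ _ (by rw [hε, hv, zero_smul]), twistLift_tmul]
  simp [hprec_one]

/-- The projection `e(a) = a'' ≺ T(a')` satisfies `e(u ≺ v) = ε(v) e(u)`. -/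
theorem twistLift_hprec_coprod_hprec (hs : ∀ x y, s (x * y) = s y * s x)
    (hε : ∀ x, twistLift K (LinearMap.mul K _).flip s (coprod K x) = counit K x • 1)
    (u v : HD K D) :
    twistLift K (hprec K).flip s (coprod K (hprec K u v)) =
      counit K v • twistLift K (hprec K).flip s (coprod K u) := by
  have h := twistLift_hprec_coprod_hprec_of_counit hs hε u (v - counit K v • 1) (by simp)
  have h1 : twistLift K (hprec K).flip s (1 : HD K D ⊗[K] HD K D) = 0 := by
    simp [Algebra.TensorProduct.one_def, twistLift_tmul, hprec_one]
  simpa [hprec_one_right, h1, sub_eq_zero] using h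

/-- The projection `φ(a) = S(a') ≻ a''` vanishes on the products `x ≻ y`. -/
theorem twistLift_hsucc_lcoprod_hsucc (hs : ∀ x y, s (x * y) = s y * s x)
    (hε : ∀ x, twistLift K (LinearMap.mul K _) s (coprod K x) = counit K x • 1)
    (x y : HD K D) (hx : counit K x = 0) (hy : counit K y = 0) :
    twistLift K (hsucc K) s (lcoprod K (hsucc K x y)) = 0 := by
  have h (X Y : HD K D ⊗[K] HD K D) (hX : twistLift K (LinearMap.mul K _) s X = 0) :
      twistLift K (hsucc K) s (map₂ (LinearMap.mul K _) (hsucc K) X Y) = 0 := by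
    induction Y using TensorProduct.induction_on with
    | zero => simp
    | add Y Y' h h' => rw [map_add, map_add, h, h', add_zero]
    | tmul c d =>
      have : twistLift K (hsucc K) s
          (map₂ (LinearMap.mul K _) (hsucc K) X (c ⊗ₜ[K] d)) =
            hsucc K (s c * twistLift K (LinearMap.mul K _) s X) d := by
        clear hX
        induction X using TensorProduct.induction_on with
        | zero => simp
        | add X X' h h' => simp only [mul_add, map_add, LinearMap.add_apply, h, h']
        | tmul a b => simp [twistLift_tmul, map₂_apply_tmul, hs, hsucc_hsucc, mul_assoc]
      rw [this, hX, mul_zero, map_zero, LinearMap.zero_apply]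
  rw [lcoprod_hsucc K x y hy, h _ _ (by rw [hε, hx, zero_smul])]

/-- The projection `φ` maps `x ≺ y` to the sum of the elements `(S(x' y') ≻ x'') ≺ y''`, so that `e`
annihilates the image, the sum of the `ε(y'') y'` being `ε(y)`. -/
theorem twistLift_twistLift_lcoprod_hprec {T : HD K D →ₗ[K] HD K D}
    (hT : ∀ x y, T (x * y) = T y * T x)
    (hε : ∀ x, twistLift K (LinearMap.mul K _).flip T (coprod K x) = counit K x • 1)
    (x y : HD K D) (hy : counit K y = 0) :
    twistLift K (hprec K).flip T
      (coprod K (twistLift K (hsucc K) s (lcoprod K (hprec K x y)))) = 0 := by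
  have h (X Y : HD K D ⊗[K] HD K D) (hY : e1 K Y = 0) :
      twistLift K (hprec K).flip T (coprod K (twistLift K (hsucc K) s
        (map₂ (LinearMap.mul K _) (hprec K) X Y))) = 0 := by
    induction X using TensorProduct.induction_on with
    | zero => simp
    | add X X' h h' => rw [map_add, LinearMap.add_apply, map_add, map_add, map_add, h, h', add_zero]
    | tmul a b =>
      have : twistLift K (hprec K).flip T (coprod K (twistLift K (hsucc K) s
          (map₂ (LinearMap.mul K _) (hprec K) (a ⊗ₜ[K] b) Y))) =
            twistLift K (hprec K).flip T (coprod K (hsucc K (s (a * e1 K Y)) b)) := by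
        clear hY
        induction Y using TensorProduct.induction_on with
        | zero => simp
        | add X X' h h' => simp only [mul_add, map_add, LinearMap.add_apply, h, h']
        | tmul c d =>
          simp [twistLift_tmul, map₂_apply_tmul, ← hsucc_hprec, e1_tmul,
            twistLift_hprec_coprod_hprec hT hε]
      rw [this, hY]
      simp
  rw [lcoprod_hprec K x y hy, h _ _ (by rw [e1_lcoprod, hy, zero_smul])]

end Projections

/-! ### Totally primitive elements -/

theorem coprod_of_mem_primTot {a : AD K D} (ha : a ∈ primTot K (AD K D)) :
    lcoprod K (incl K a) = 1 ⊗ₜ[K] incl K a ∧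
      coprod K (incl K a) = incl K a ⊗ₜ[K] 1 + 1 ⊗ₜ[K] incl K a := by
  have hr : acoprec K a = 0 := ha.1
  have hl : acosucc K a = 0 := ha.2
  have hr' := incl₂_acoprec K a
  have hl' := incl₂_acosucc K a
  rw [hr, map_zero] at hr'
  rw [hl, map_zero] at hl'
  refine ⟨?_, by rw [coprod_eq, rd, LinearMap.add_apply, ← hr', ← hl']; simp⟩
  rw [ll_apply] at hl'
  exact (sub_eq_zero.1 hl'.symm)

theorem vertex_mem_primTot (d : D) : vertex K d ∈ primTot K (AD K D) :=
  ⟨acoprec_vertex K d, acosucc_vertex K d⟩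

/-- A linear endomorphism that fixes the totally primitive elements and annihilates the products
`x ≺ y` and `x ≻ y` of elements of the augmentation ideal. -/
theorem exists_primTot_projection : ∃ E : HD K D →ₗ[K] HD K D, E 1 = 0 ∧
    (∀ a ∈ primTot K (AD K D), E (incl K a) = incl K a) ∧
    (∀ x y, counit K x = 0 → counit K y = 0 → E (hprec K x y) = 0) ∧
    ∀ x y, counit K x = 0 → counit K y = 0 → E (hsucc K x y) = 0 := by
  obtain ⟨S, hS1, hS, hSε⟩ := exists_antipode K (D := D)
  obtain ⟨T, hT1, hT, hTε⟩ := exists_skew_antipode K (D := D)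
  refine ⟨twistLift K (hprec K).flip T ∘ₗ (coprod K (D := D)).toLinearMap ∘ₗ
    twistLift K (hsucc K) S ∘ₗ lcoprod K, ?_, fun a ha => ?_, fun x y _ hy => ?_,
    fun x y hx hy => ?_⟩
  · simp [lcoprod_one, Algebra.TensorProduct.one_def, twistLift_tmul, hS1, hsucc_one', hprec_one]
  · obtain ⟨h1, h2⟩ := coprod_of_mem_primTot K ha
    simp [h1, h2, twistLift_tmul, hS1, hT1, hsucc_one', hprec_one, hprec_one_right, counit_incl]
  · exact twistLift_twistLift_lcoprod_hprec hT hTε x y hy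
  · simp [twistLift_hsucc_lcoprod_hsucc hS hSε x y hx hy]

theorem primTot_le_span_vertex :
    primTot K (AD K D) ≤ Submodule.span K (Set.range (vertex K (D := D))) := by
  obtain ⟨E, hE1, hE, hprec0, hsucc0⟩ := exists_primTot_projection K (D := D)
  have hmon (l : List (PTree D)) :
      E (mon K l) ∈ (Submodule.span K (Set.range (vertex K (D := D)))).map (incl K) := by
    match l with
    | [] => rw [mon_nil, hE1]; exact zero_mem _
    | [PTree.node d []] =>
      have hv : mon K [PTree.node d []] = incl K (vertex K d) := by
        rw [vertex_eq_graft, ← mon_nil, graft_mon]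
      rw [hv, hE _ (vertex_mem_primTot K d)]
      exact Submodule.mem_map_of_mem (Submodule.subset_span ⟨d, rfl⟩)
    | [PTree.node d (t :: l)] =>
      have hg : mon K [PTree.node d (t :: l)] = hprec K (graft K d 1) (mon K (t :: l)) := by
        rw [hprec_graft, one_mul, graft_mon]
      rw [hg, hprec0 _ _ (counit_graft K d 1) (counit_cons K t l)]
      exact zero_mem _
    | t :: t' :: l =>
      have hm : mon K (t :: t' :: l) =
          hprec K (mon K [t]) (mon K (t' :: l)) + hsucc K (mon K [t]) (mon K (t' :: l)) := by
        rw [hsucc_apply, ← mon_cons, add_sub_cancel]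
      rw [hm, map_add, hprec0 _ _ (counit_tree K t) (counit_cons K t' l),
        hsucc0 _ _ (counit_tree K t) (counit_cons K t' l), add_zero]
      exact zero_mem _
  intro a ha
  have hspan : E (incl K a) ∈
      (Submodule.span K (Set.range (vertex K (D := D)))).map (incl K) := by
    -- `x ↦ E x` modulo the span vanishes on the basis of forests.
    have hq : (Submodule.mkQ _) ∘ₗ E = 0 := hd_ext K fun l =>
      (Submodule.Quotient.mk_eq_zero _).2 (hmon l)
    exact (Submodule.Quotient.mk_eq_zero _).1 (LinearMap.congr_fun hq (incl K a))
  rw [hE a ha] at hspan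
  obtain ⟨b, hb, hab⟩ := hspan
  rwa [← incl_injective K hab]

end Antipode

end Bidend

theorem mainTheorem6 (K D : Type*) [Field K] :
    Bidend.primTot K (Bidend.AD K D) =
      Submodule.span K (Set.range (fun d : D => Bidend.vertex K d)) := by
  refine le_antisymm (Bidend.primTot_le_span_vertex K) (Submodule.span_le.2 ?_)
  rintro _ ⟨d, rfl⟩
  exact Bidend.vertex_mem_primTot K d
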